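/- We work over $\mathbb{C}$, with the Zariski topology; a variety is a closed subset of a projective space, and non-degenerate means not contained in a hyperplane. For $X\subset\mathbb{P}^{2n+1}$, a proper secant line is a line spanned by two distinct points of $X$; a secant line is a line belonging to the Zariski closure, in the Grassmannian of lines, of the set of proper secant lines; $\mathrm{Sec}(X)$ is the Zariski closure of the union of the proper secant lines. An irreducible, non-degenerate variety $X\subset\mathbb{P}^{2n+1}$ of dimension $n$ with $\mathrm{Sec}(X)=\mathbb{P}^{2n+1}$ (i.e. not secant defective) is called an OADP variety if through a general point of $\mathbb{P}^{2n+1}$ there is exactly one secant line to $X$, spanned by a unique pair of distinct points of $X$ (equivalently, if the projection of the abstract secant variety of $X$ to $\mathbb{P}^{2n+1}$ is birational). Let $m<n$, let $V,W\subset\mathbb{P}^{2n+1}$ be disjoint linear subspaces of dimensions $2m+1$ and $2(n-m)-1$, and let $Y\subset V$ be an OADP variety of dimension $m$ in $V\cong\mathbb{P}^{2m+1}$. Let $C_W(Y)=\bigcup_{y\in Y}\langle y,W\rangle$ be the cone over $Y$ with vertex $W$. A Verra variety of dimension $n$ is an irreducible, non-degenerate, not secant defective variety $X\subset\mathbb{P}^{2n+1}$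 of dimension $n$, contained in such a cone $C_W(Y)$, which meets the general ruling along a linear space of dimension $n-m$ outside the vertex: for $y$ in a non-empty open subset of $Y$ there is a linear space $P\not\subset W$ of dimension $n-m$ such that $(X\cap\langle y,W\rangle)\setminus W=P\setminus W$. Proposition (A. Verra). Every Verra variety $X\subset\mathbb{P}^{2n+1}$ of dimension $n$ is an OADP variety. In particular, through a general point of $\mathbb{P}^{2n+1}$ there is exactly one secant line to $X$. -/

import Mathlib

open scoped LinearAlgebra.Projectivization

namespace OADP

variable {E : Type*} [AddCommGroup E] [Module ℂ E]

/-- The value at the vector `v` of a polynomial in the linear forms of `E`. -/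
noncomputable def value (F : MvPolynomial (Module.Dual ℂ E) ℂ) (v : E) : ℂ :=
  MvPolynomial.eval (fun φ : Module.Dual ℂ E => φ v) F

/-- The common zeros in `ℙ(E)` of a set of polynomials in the linear forms of `E`. It is used for
homogeneous polynomials only, whose vanishing does not depend on the representative. -/
def zeroLocus (S : Set (MvPolynomial (Module.Dual ℂ E) ℂ)) : Set (ℙ ℂ E) :=
  {p | ∀ F ∈ S, value F p.rep = 0}

/-- A Zariski closed subset of `ℙ(E)`: the zero locus of a set of homogeneous polynomials. -/
def IsZariskiClosed (Z : Set (ℙ ℂ E)) : Prop :=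
  ∃ S : Set (MvPolynomial (Module.Dual ℂ E) ℂ),
    (∀ F ∈ S, ∃ d : ℕ, F.IsHomogeneous d) ∧ Z = zeroLocus S

theorem isZariskiClosed_empty : IsZariskiClosed (∅ : Set (ℙ ℂ E)) := by
  refine ⟨{1}, ?_, ?_⟩
  · rintro F rfl
    exact ⟨0, MvPolynomial.isHomogeneous_one _ _⟩
  · ext p
    simp [zeroLocus, value]

theorem isZariskiClosed_sInter (A : Set (Set (ℙ ℂ E))) (hA : ∀ Z ∈ A, IsZariskiClosed Z) :
    IsZariskiClosed (⋂₀ A) := by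
  refine ⟨{F | (∃ d : ℕ, F.IsHomogeneous d) ∧ ∀ p ∈ ⋂₀ A, value F p.rep = 0},
    fun F hF => hF.1, ?_⟩
  ext p
  constructor
  · intro hp F hF
    exact hF.2 p hp
  · intro hp Z hZ
    obtain ⟨S, hS, rfl⟩ := hA Z hZ
    intro F hF
    exact hp F ⟨hS F hF, fun q hq => hq _ hZ F hF⟩

theorem isZariskiClosed_union (Z₁ : Set (ℙ ℂ E)) (h₁ : IsZariskiClosed Z₁) (Z₂ : Set (ℙ ℂ E))
    (h₂ : IsZariskiClosed Z₂) : IsZariskiClosed (Z₁ ∪ Z₂) := by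
  obtain ⟨S, hS, rfl⟩ := h₁
  obtain ⟨T, hT, rfl⟩ := h₂
  refine ⟨{H | ∃ F ∈ S, ∃ G ∈ T, H = F * G}, ?_, ?_⟩
  · rintro H ⟨F, hF, G, hG, rfl⟩
    obtain ⟨d, hd⟩ := hS F hF
    obtain ⟨e, he⟩ := hT G hG
    exact ⟨d + e, hd.mul he⟩
  · ext p
    constructor
    · rintro (hp | hp) H ⟨F, hF, G, hG, rfl⟩
      · have h0 := hp F hF
        simp only [value] at h0 ⊢
        rw [map_mul, h0, zero_mul]
      · have h0 := hp G hG
        simp only [value] at h0 ⊢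
        rw [map_mul, h0, mul_zero]
    · intro hp
      by_contra hcon
      simp only [zeroLocus, Set.mem_union, Set.mem_ofPred_eq, not_or, not_forall] at hcon
      obtain ⟨⟨F, hF, hF0⟩, G, hG, hG0⟩ := hcon
      have h0 := hp (F * G) ⟨F, hF, G, hG, rfl⟩
      simp only [value] at h0 hF0 hG0
      rw [map_mul] at h0
      exact (mul_ne_zero hF0 hG0) h0

/-- The Zariski topology on `ℙ(E)`. -/
instance zariskiTopology : TopologicalSpace (ℙ ℂ E) :=
  TopologicalSpace.ofClosed {Z | IsZariskiClosed Z} isZariskiClosed_empty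
    isZariskiClosed_sInter isZariskiClosed_union

/-- The linear span of a set of points of `ℙ(E)`, as a vector subspace of `E`. A linear subspace
of `ℙ(E)` of dimension `k` is given by a vector subspace of dimension `k + 1`; the point `p` lies
on it if and only if `p.submodule` is contained in that vector subspace. -/
noncomputable def linSpan (S : Set (ℙ ℂ E)) : Submodule ℂ E :=
  ⨆ x ∈ S, x.submodule

/-- `X` is an irreducible, non-degenerate (closed) subvariety of dimension `n` of `ℙ(E)`. -/
structure IsNondegenerateVariety (n : ℕ) (X : Set (ℙ ℂ E)) : Prop where
  closed : IsClosed X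
  irreducible : IsIrreducible X
  dim_eq : topologicalKrullDim X = n
  nondegenerate : linSpan X = ⊤

/-- A proper secant line: the line spanned by two distinct points of `X`. -/
def IsProperSecantLine (X : Set (ℙ ℂ E)) (L : Submodule ℂ E) : Prop :=
  ∃ x ∈ X, ∃ y ∈ X, x ≠ y ∧ L = x.submodule ⊔ y.submodule

/-- The secant variety: the Zariski closure of the union of all proper secant lines. -/
def secantVariety (X : Set (ℙ ℂ E)) : Set (ℙ ℂ E) :=
  closure {p | ∃ L, IsProperSecantLine X L ∧ p.submodule ≤ L}

/-- `w ∈ ℙ(⋀² E)` is the Plücker point of the line `L` of `ℙ(E)`, i.e. `w = [x ∧ y]` where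
`x, y` is a basis of `L`. (As `w` is a point, `x ∧ y ≠ 0`, so that `L` has dimension two.) -/
def IsPluckerPoint (L : Submodule ℂ E) (w : ℙ ℂ (⋀[ℂ]^2 E)) : Prop :=
  ∃ x y : E, L = Submodule.span ℂ {x, y} ∧
    w.submodule = Submodule.span ℂ {exteriorPower.ιMulti ℂ 2 ![x, y]}

/-- A secant line, proper or improper: a line in the Zariski closure, inside the Grassmannian of
lines in its Plücker embedding, of the set of proper secant lines. -/
def IsSecantLine (X : Set (ℙ ℂ E)) (L : Submodule ℂ E) : Prop :=
  ∃ w, IsPluckerPoint L w ∧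
    w ∈ closure {w' | ∃ L', IsProperSecantLine X L' ∧ IsPluckerPoint L' w'}

/-- `X ⊆ ℙ(E) = ℙ²ⁿ⁺¹` is a variety with one apparent double point: it is irreducible,
non-degenerate, of dimension `n`, its secant variety is the whole space, and the projection of its
abstract secant variety to `ℙ²ⁿ⁺¹` is birational, i.e. through a general point there is a unique
secant line (proper or improper), coming from a unique pair of distinct points of `X`. -/
structure IsOADP (n : ℕ) (X : Set (ℙ ℂ E)) : Prop where
  ambient : Module.finrank ℂ E = 2 * n + 2
  isVariety : IsNondegenerateVariety n X
  not_defective : secantVariety X = Set.univ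
  one_secant : ∃ U : Set (ℙ ℂ E), IsOpen U ∧ U.Nonempty ∧ ∀ p ∈ U,
    (∃! L : Submodule ℂ E, IsSecantLine X L ∧ p.submodule ≤ L) ∧
    (∃! ξ : Set (ℙ ℂ E), ξ ⊆ X ∧ ξ.ncard = 2 ∧ p.submodule ≤ linSpan ξ)

/-- For a point `y` of the linear subspace `ℙ(V)`, the ruling `⟨y, W⟩` of the cones with
vertex `W`. -/
noncomputable def ruling {V : Submodule ℂ E} (W : Submodule ℂ E) (y : ℙ ℂ V) : Submodule ℂ E :=
  y.submodule.map V.subtype ⊔ W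

/-- The cone over `Y ⊆ ℙ(V)` with vertex `W`. -/
def cone {V : Submodule ℂ E} (W : Submodule ℂ E) (Y : Set (ℙ ℂ V)) : Set (ℙ ℂ E) :=
  {p | ∃ y ∈ Y, p.submodule ≤ ruling W y}

/-- `X ⊆ ℙ(E) = ℙ²ⁿ⁺¹` is a Verra variety of dimension `n`, constructed from the OADP variety
`Y` of dimension `m < n` in the linear space `V` of dimension `2m + 1` and from the linear space
`W` of dimension `2(n - m) - 1` disjoint from `V`.

That `X` cuts the ruling `⟨y, W⟩` along the linear space `P` of dimension `n - m` refers to the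
part outside of the vertex, i.e. `P` is the closure of the fibre over `y` of the projection
of `X` from `W`. -/
structure IsVerraOver (n m : ℕ) (V W : Submodule ℂ E) (Y : Set (ℙ ℂ V))
    (X : Set (ℙ ℂ E)) : Prop where
  ambient : Module.finrank ℂ E = 2 * n + 2
  lt : m < n
  base : IsOADP m Y
  finrank_vertex : Module.finrank ℂ W = 2 * (n - m)
  disjoint : Disjoint V W
  isVariety : IsNondegenerateVariety n X
  not_defective : secantVariety X = Set.univ
  subset_cone : X ⊆ cone W Y
  linear_fibre : ∃ U : Set (ℙ ℂ V), IsOpen U ∧ (U ∩ Y).Nonempty ∧ ∀ y ∈ U ∩ Y,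
    ∃ P : Submodule ℂ E, Module.finrank ℂ P = n - m + 1 ∧ ¬ P ≤ W ∧
      {x ∈ X | x.submodule ≤ ruling W y ∧ ¬ x.submodule ≤ W} =
        {x | x.submodule ≤ P ∧ ¬ x.submodule ≤ W}

/-- Verra varieties of dimension `n`. -/
def IsVerra (n : ℕ) (X : Set (ℙ ℂ E)) : Prop :=
  ∃ (m : ℕ) (V W : Submodule ℂ E) (Y : Set (ℙ ℂ V)), IsVerraOver n m V W Y X

end OADP

namespace OADP

-- Commutative algebra: points of finite type algebras, Chevalley, and functions constant on fibres.

universe u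

/-! Write `E = V ⊕ W` and let `π` be the projection onto `V`; it maps the cone over `X` into the
cone over `Y`. As `X` is not defective, Chevalley's theorem (`exists_open_subset_image`) writes a
general vector `v` as `x₁ + x₂` with both summands in the cone over `X`. Then `π v = π x₁ + π x₂`,
and since `Y` is OADP the pair of points `[π x₁], [π x₂]` is determined by `[π v]`. So in every such
decomposition the summands lie, up to order, in the two linear fibres `P₁, P₂` over these points.
For `w ∈ W`, a suitable `v + t • w` with `t ≠ 0` is also general and has the same projection, hence
lies in `P₁ ⊔ P₂`; thus `W ≤ P₁ ⊔ P₂`. Counting dimensions, `P₁` and `P₂` meet only in `0`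
(`disjoint_of_vertex_le`), so the decomposition is unique up to order
(`IsVerraOver.exists_decomposition`).

Improper secant lines remain to be excluded (`exists_unique_secantLine`). For linear forms `α, β` on
bivectors, the product of `α (x₁ ∧ x₂)` and `β (x₁ ∧ x₂)` is symmetric in the two vectors, so over a
general `v` it depends only on `v`; in characteristic zero it is then a rational function of `v`
(`exists_mul_eq_comp`). Contracting a Plücker vector with a linear form gives vectors of the line,
and for a proper secant line these are again sums of two vectors of the cone. Hence the Plücker
vectors of proper secant lines satisfy polynomial equations that pass to the closure, and these
force any secant line through a general `v` to have the Plücker coordinates of `⟨x₁, x₂⟩`. -/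

theorem exists_algHom_eq_zero_of_ne_top (A : Type*) [CommRing A] [Algebra ℂ A]
    [Algebra.FiniteType ℂ A] (I : Ideal A) (hI : I ≠ ⊤) :
    ∃ ψ : A →ₐ[ℂ] ℂ, ∀ a ∈ I, ψ a = 0 := by
  obtain ⟨m, hm, hIm⟩ := Ideal.exists_le_maximal I hI
  let _ : Field (A ⧸ m) := Ideal.Quotient.field m
  have : Module.Finite ℂ (A ⧸ m) := finite_of_finite_type_of_isJacobsonRing ℂ (A ⧸ m)
  have hb : Function.Bijective (algebraMap ℂ (A ⧸ m)) :=
    IsAlgClosed.algebraMap_bijective_of_isIntegral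
  let e : ℂ ≃ₐ[ℂ] (A ⧸ m) := AlgEquiv.ofBijective (Algebra.ofId ℂ (A ⧸ m)) hb
  refine ⟨e.symm.toAlgHom.comp (Ideal.Quotient.mkₐ ℂ m), fun a ha => ?_⟩
  have h0 : Ideal.Quotient.mkₐ ℂ m a = 0 := Ideal.Quotient.eq_zero_iff_mem.2 (hIm ha)
  rw [AlgHom.comp_apply, h0, map_zero]

theorem exists_algHom_ne_zero {A : Type*} [CommRing A] [IsDomain A] [Algebra ℂ A]
    [Algebra.FiniteType ℂ A] (b : A) (hb : b ≠ 0) : ∃ ψ : A →ₐ[ℂ] ℂ, ψ b ≠ 0 := by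
  let B := Localization.Away b
  have : Nontrivial B := by
    have := IsLocalization.injective B (powers_le_nonZeroDivisors_of_noZeroDivisors hb)
    exact this.nontrivial
  have : Algebra.FiniteType A B := IsLocalization.finiteType_of_monoid_fg (Submonoid.powers b) B
  have : Algebra.FiniteType ℂ B := Algebra.FiniteType.trans (S := A) inferInstance inferInstance
  obtain ⟨ψ, -⟩ := exists_algHom_eq_zero_of_ne_top B ⊥ bot_ne_top
  refine ⟨ψ.comp (IsScalarTower.toAlgHom ℂ A B), fun h => ?_⟩
  have hu : IsUnit (ψ (algebraMap A B b)) := (IsLocalization.Away.algebraMap_isUnit b).map ψ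
  exact hu.ne_zero h

open Topology in
/-- A constructible set containing a generic point contains a nonempty open set. -/
theorem exists_isOpen_subset_of_isConstructible {T : Type*} [TopologicalSpace T] (η : T)
    (hη : ∀ x, η ⤳ x) {s : Set T} (hs : IsConstructible s) :
    (∃ U, IsOpen U ∧ η ∈ U ∧ U ⊆ s) ∨ (∃ U, IsOpen U ∧ η ∈ U ∧ U ⊆ sᶜ) := by
  induction hs using IsConstructible.empty_union_induction with
  | open_retrocompact U hU _ =>
    by_cases h : η ∈ U
    · exact Or.inl ⟨U, hU, h, subset_rfl⟩
    · exact Or.inr ⟨Set.univ, isOpen_univ, trivial,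
        fun x _ hx => h ((hη x).mem_open hU hx)⟩
  | union s _ t _ hs ht =>
    rcases hs with ⟨U, hU, h, hs⟩ | ⟨U, hU, h, hs⟩
    · exact Or.inl ⟨U, hU, h, hs.trans Set.subset_union_left⟩
    rcases ht with ⟨U', hU', h', ht⟩ | ⟨U', hU', h', ht⟩
    · exact Or.inl ⟨U', hU', h', ht.trans Set.subset_union_right⟩
    · refine Or.inr ⟨U ∩ U', hU.inter hU', ⟨h, h'⟩, ?_⟩
      rw [Set.compl_union]
      exact Set.inter_subset_inter hs ht
  | compl s _ hs =>
    rw [compl_compl]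
    exact hs.symm

/-- By Chevalley, the image of the spectrum of the localization `A_b` in that of `R` is
constructible; it contains the generic point because `i` is injective, hence it contains a basic
open set `D(c)`. -/
theorem exists_ne_zero_forall_exists_extension {R A : Type*} [CommRing R] [IsDomain R]
    [Algebra ℂ R] [Algebra.FiniteType ℂ R] [CommRing A] [IsDomain A] [Algebra ℂ A]
    [Algebra.FiniteType ℂ A] (i : R →ₐ[ℂ] A) (hi : Function.Injective i) (b : A) (hb : b ≠ 0) :
    ∃ c : R, c ≠ 0 ∧ ∀ φ : R →ₐ[ℂ] ℂ, φ c ≠ 0 → ∃ ψ : A →ₐ[ℂ] ℂ, ψ.comp i = φ ∧ ψ b ≠ 0 := by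
  have : IsNoetherianRing R := Algebra.FiniteType.isNoetherianRing ℂ R
  let B := Localization.Away b
  have hAB : Function.Injective (algebraMap A B) :=
    IsLocalization.injective B (powers_le_nonZeroDivisors_of_noZeroDivisors hb)
  have : IsDomain B := IsLocalization.isDomain_localization
    (powers_le_nonZeroDivisors_of_noZeroDivisors hb)
  have : Algebra.FiniteType A B := IsLocalization.finiteType_of_monoid_fg (Submonoid.powers b) B
  have hfB : Algebra.FiniteType ℂ B :=
    Algebra.FiniteType.trans (S := A) inferInstance inferInstance
  let j : R →ₐ[ℂ] B := (IsScalarTower.toAlgHom ℂ A B).comp i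
  have hj : Function.Injective j := hAB.comp hi
  have hft : j.toRingHom.FiniteType := by
    have h1 : (j.toRingHom.comp (algebraMap ℂ R)).FiniteType := by
      have : j.toRingHom.comp (algebraMap ℂ R) = algebraMap ℂ B := j.comp_algebraMap
      rw [this]
      exact (RingHom.finiteType_algebraMap).2 hfB
    exact RingHom.FiniteType.of_comp_finiteType h1
  have hfp : j.toRingHom.FinitePresentation := RingHom.FinitePresentation.of_finiteType.1 hft
  have hc := PrimeSpectrum.isConstructible_range_comap hfp
  let η : PrimeSpectrum R := ⟨⊥, Ideal.isPrime_bot⟩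
  have hη : ∀ x, η ⤳ x := fun x => by
    rw [← PrimeSpectrum.le_iff_specializes]
    exact (bot_le : (⊥ : Ideal R) ≤ x.asIdeal)
  have hmem : η ∈ Set.range (PrimeSpectrum.comap j.toRingHom) := by
    refine ⟨⟨⊥, Ideal.isPrime_bot⟩, ?_⟩
    ext x
    change j x = 0 ↔ x = 0
    exact map_eq_zero_iff j hj
  rcases exists_isOpen_subset_of_isConstructible η hη hc with ⟨U, hU, hηU, hUs⟩ | ⟨U, hU, hηU, hUs⟩
  swap
  · exact absurd hmem (hUs hηU)
  obtain ⟨_, ⟨c, rfl⟩, hηc, hcU⟩ :=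
    PrimeSpectrum.isTopologicalBasis_basic_opens.exists_subset_of_mem_open hηU hU
  refine ⟨c, fun h => hηc (by simp [h]), fun φ hφ => ?_⟩
  let q : PrimeSpectrum R := ⟨RingHom.ker φ, RingHom.ker_isPrime φ⟩
  obtain ⟨Q, hQ⟩ := hUs (hcU (show q ∈ _ from hφ))
  -- Any complex point of `B` killing `Q` works: `Q` lies over `ker φ`, which contains every `x -
  -- φ(x)`, so its restriction to `R` must be `φ`.
  obtain ⟨ψ, hψ⟩ := exists_algHom_eq_zero_of_ne_top B Q.asIdeal Q.isPrime.ne_top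
  refine ⟨ψ.comp (IsScalarTower.toAlgHom ℂ A B), ?_, ?_⟩
  · ext x
    have hx : x - algebraMap ℂ R (φ x) ∈ q.asIdeal := by
      change φ _ = 0
      simp
    rw [← hQ] at hx
    have h0 : ψ (j (x - algebraMap ℂ R (φ x))) = 0 := hψ _ hx
    rw [map_sub, map_sub, AlgHom.commutes, AlgHom.commutes, sub_eq_zero] at h0
    exact h0
  · have hu : IsUnit (ψ (algebraMap A B b)) := (IsLocalization.Away.algebraMap_isUnit b).map ψ
    exact hu.ne_zero

open scoped TensorProduct in
theorem exists_field_amalgam {F L₁ L₂ : Type u} [Field F] [Field L₁] [Field L₂]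
    (f : F →+* L₁) (g : F →+* L₂) :
    ∃ (Ω : Type u) (_ : Field Ω) (σ : L₁ →+* Ω) (τ : L₂ →+* Ω), σ.comp f = τ.comp g := by
  algebraize [f, g]
  obtain ⟨m, hm⟩ := Ideal.exists_maximal (L₁ ⊗[F] L₂)
  refine ⟨(L₁ ⊗[F] L₂) ⧸ m, Ideal.Quotient.field m,
    (Ideal.Quotient.mk m).comp Algebra.TensorProduct.includeLeftRingHom,
    (Ideal.Quotient.mk m).comp (Algebra.TensorProduct.includeRight (R := F) (A := L₁)).toRingHom,
    ?_⟩
  have h := Algebra.TensorProduct.includeLeftRingHom_comp_algebraMap (R := F) (A := L₁) (B := L₂)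
  ext x
  exact congrArg (Ideal.Quotient.mk m) (RingHom.congr_fun h x)

open scoped IntermediateField in
-- If `a` is algebraic, separability gives a second conjugate, since the degree is at least two. If
-- `a` is transcendental, it can be sent to `a + 1`.
theorem exists_algHom_adjoin_simple_gen_ne {K L : Type*} [Field K] [CharZero K] [Field L]
    [Algebra K L] (a : L) (ha : a ∉ (algebraMap K L).range) :
    ∃ f : K⟮a⟯ →ₐ[K] AlgebraicClosure L,
      f (IntermediateField.AdjoinSimple.gen K a) ≠ algebraMap L (AlgebraicClosure L) a := by
  by_cases hal : IsIntegral K a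
  · have h2 := (minpoly.two_le_natDegree_iff hal).2 ha
    have hcard : Fintype.card ((minpoly K a).rootSet (AlgebraicClosure L)) =
        (minpoly K a).natDegree :=
      Polynomial.card_rootSet_eq_natDegree (minpoly.irreducible hal).separable
        (IsAlgClosed.splits _)
    obtain ⟨x, hx⟩ := Fintype.exists_ne_of_one_lt_card (by omega : 1 < Fintype.card
      ((minpoly K a).rootSet (AlgebraicClosure L)))
      ⟨algebraMap L _ a, by simp [Polynomial.mem_rootSet, minpoly.ne_zero hal]⟩
    refine ⟨(IntermediateField.algHomAdjoinIntegralEquiv K hal).symm ⟨x, ?_⟩, ?_⟩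
    · rw [Polynomial.mem_aroots]
      exact Polynomial.mem_rootSet.1 x.2
    · rw [IntermediateField.algHomAdjoinIntegralEquiv_symm_apply_gen]
      exact fun h => hx (Subtype.ext h)
  · have hta : Transcendental K a := fun h => hal h.isIntegral
    have htb : Transcendental K (a + 1) := fun h => hal (by
      simpa using h.isIntegral.sub isIntegral_one)
    refine ⟨(IsScalarTower.toAlgHom K L (AlgebraicClosure L)).comp ((K⟮a + 1⟯).val.comp
      ((RatFunc.algEquivOfTranscendental a hta).symm.trans
        (RatFunc.algEquivOfTranscendental (a + 1) htb)).toAlgHom), ?_⟩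
    simp

open scoped IntermediateField in
-- Over `K(a)`, amalgamate `L` by the inclusion with its algebraic closure by an embedding that
-- moves `a`.
theorem exists_ringHoms_apply_ne {K L : Type u} [Field K] [CharZero K] [Field L] [Algebra K L]
    (a : L) (ha : a ∉ (algebraMap K L).range) :
    ∃ (Ω : Type u) (_ : Field Ω) (σ τ : L →+* Ω),
      σ.comp (algebraMap K L) = τ.comp (algebraMap K L) ∧ σ a ≠ τ a := by
  obtain ⟨f, hf⟩ := exists_algHom_adjoin_simple_gen_ne a ha
  obtain ⟨Ω, hΩ, σ, τ, h⟩ := exists_field_amalgam (algebraMap K⟮a⟯ L) f.toRingHom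
  refine ⟨Ω, hΩ, σ, τ.comp (algebraMap L (AlgebraicClosure L)), ?_, ?_⟩
  · ext x
    have hx := RingHom.congr_fun h (algebraMap K K⟮a⟯ x)
    have h2 : f (algebraMap K K⟮a⟯ x) = algebraMap L (AlgebraicClosure L) (algebraMap K L x) := by
      rw [f.commutes]
      exact IsScalarTower.algebraMap_apply K L (AlgebraicClosure L) x
    simpa [h2] using hx
  · intro h0
    have hx := RingHom.congr_fun h (IntermediateField.AdjoinSimple.gen K a)
    exact hf (τ.injective (hx.symm.trans h0))

/-- A regular function whose value at a general point depends only on the image of the point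
under a dominant morphism is a quotient of functions pulled back along the morphism. -/
theorem exists_mul_eq_of_forall_algHom_eq {R A : Type u} [CommRing R] [IsDomain R]
    [Algebra ℂ R] [CommRing A] [IsDomain A] [Algebra ℂ A]
    [Algebra.FiniteType ℂ A] (i : R →ₐ[ℂ] A) (hi : Function.Injective i) (a : A) (c : R)
    (hc : c ≠ 0) (h : ∀ ψ₁ ψ₂ : A →ₐ[ℂ] ℂ, ψ₁.comp i = ψ₂.comp i → ψ₁ (i c) ≠ 0 → ψ₁ a = ψ₂ a) :
    ∃ d e : R, d ≠ 0 ∧ i d * a = i e := by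
  let K := FractionRing R
  let L := FractionRing A
  have hjinj : Function.Injective ((algebraMap A L).comp i.toRingHom) :=
    (IsFractionRing.injective A L).comp hi
  let κ : K →+* L := IsFractionRing.lift hjinj
  have hκ : ∀ r, κ (algebraMap R K r) = algebraMap A L (i r) := fun r =>
    IsFractionRing.lift_algebraMap hjinj r
  let _ : Algebra K L := κ.toAlgebra
  have : CharZero R := Algebra.charZero_of_charZero ℂ R
  have : CharZero K := IsFractionRing.charZero_of_isFractionRing R (K := K)
  by_cases ha : algebraMap A L a ∈ (algebraMap K L).range
  · obtain ⟨k, hk⟩ := ha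
    obtain ⟨e, d, hd, rfl⟩ := IsFractionRing.div_surjective (A := R) k
    have hd0 : d ≠ 0 := nonZeroDivisors.ne_zero hd
    refine ⟨d, e, hd0, IsFractionRing.injective A L ?_⟩
    have hk' : κ (algebraMap R K e / algebraMap R K d) = algebraMap A L a := hk
    have hid : algebraMap A L (i d) ≠ 0 := by
      rw [← hκ]
      simpa using hd0
    rw [map_div₀, hκ, hκ, div_eq_iff hid] at hk'
    rw [hk', map_mul, mul_comm]
  · exfalso
    -- The two embeddings form a generic pair of points in one fibre, separated by `a`. The algebra
    -- `B` generated by both images of `A` is a domain of finite type, so the pair specializes to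
    -- complex points that are still separated by `a` and where `c` does not vanish.
    obtain ⟨Ω, _, σ, τ, hστ, hne⟩ := exists_ringHoms_apply_ne _ ha
    let s : A →+* Ω := σ.comp (algebraMap A L)
    let t : A →+* Ω := τ.comp (algebraMap A L)
    have hst : ∀ r, s (i r) = t (i r) := fun r => by
      have := RingHom.congr_fun hστ (algebraMap R K r)
      change σ (κ _) = τ (κ _) at this
      rwa [hκ] at this
    let _ : Algebra ℂ Ω := (s.comp (algebraMap ℂ A)).toAlgebra
    let s' : A →ₐ[ℂ] Ω := { s with commutes' := fun r => rfl }
    have htc : ∀ r : ℂ, t (algebraMap ℂ A r) = algebraMap ℂ Ω r := fun r => by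
      rw [← i.commutes, ← hst, i.commutes]
      rfl
    let t' : A →ₐ[ℂ] Ω := { t with commutes' := htc }
    let B : Subalgebra ℂ Ω := s'.range ⊔ t'.range
    have hfg : B.FG := by
      refine Subalgebra.FG.sup ?_ ?_
      · rw [← Algebra.map_top]
        exact Algebra.FiniteType.out.map s'
      · rw [← Algebra.map_top]
        exact Algebra.FiniteType.out.map t'
    have : Algebra.FiniteType ℂ B := (Subalgebra.fg_iff_finiteType B).1 hfg
    let s₁ : A →ₐ[ℂ] B := s'.codRestrict B fun x =>
      (le_sup_left : s'.range ≤ B) ⟨x, rfl⟩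
    let t₁ : A →ₐ[ℂ] B := t'.codRestrict B fun x =>
      (le_sup_right : t'.range ≤ B) ⟨x, rfl⟩
    have hb : (s₁ a - t₁ a) * s₁ (i c) ≠ 0 := by
      refine mul_ne_zero (sub_ne_zero.2 fun h0 => hne (congrArg Subtype.val h0)) fun h0 => ?_
      have h1 : s (i c) = 0 := congrArg Subtype.val h0
      rw [map_eq_zero_iff s (σ.injective.comp (IsFractionRing.injective A L)),
        map_eq_zero_iff i hi] at h1
      exact hc h1
    obtain ⟨ψ, hψ⟩ := exists_algHom_ne_zero _ hb
    rw [map_mul, map_sub] at hψ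
    refine (left_ne_zero_of_mul hψ) (sub_eq_zero.2 ?_)
    refine h (ψ.comp s₁) (ψ.comp t₁) ?_ (right_ne_zero_of_mul hψ)
    ext r
    exact congrArg ψ (Subtype.ext (hst r))

/-! ### Polynomial functions and affine varieties in a vector space. -/

section PolyFun

variable {F : Type*} [AddCommGroup F] [Module ℂ F]
variable {F' : Type*} [AddCommGroup F'] [Module ℂ F']

variable (F) in
/-- The algebra of polynomial functions on a complex vector space. -/
def polyFun : Subalgebra ℂ (F → ℂ) :=
  Algebra.adjoin ℂ (Set.range fun φ : Module.Dual ℂ F => (φ : F → ℂ))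

theorem dual_mem_polyFun (φ : Module.Dual ℂ F) : (φ : F → ℂ) ∈ polyFun F :=
  Algebra.subset_adjoin ⟨φ, rfl⟩

theorem const_mem_polyFun (a : ℂ) : (fun _ : F => a) ∈ polyFun F :=
  (polyFun F).algebraMap_mem a

theorem polyFun_eq_range :
    polyFun F = (MvPolynomial.aeval fun φ : Module.Dual ℂ F => (φ : F → ℂ)).range :=
  Algebra.adjoin_range_eq_range_aeval ℂ _

theorem aeval_apply_eq_value (G : MvPolynomial (Module.Dual ℂ F) ℂ) (v : F) :
    MvPolynomial.aeval (fun φ : Module.Dual ℂ F => (φ : F → ℂ)) G v = value G v := by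
  induction G using MvPolynomial.induction_on with
  | C a => simp [value]
  | add p q hp hq => simp_all [value]
  | mul_X p φ hp => simp_all [value]

theorem value_mem_polyFun (G : MvPolynomial (Module.Dual ℂ F) ℂ) : value G ∈ polyFun F := by
  rw [polyFun_eq_range]
  exact ⟨G, funext (aeval_apply_eq_value G)⟩

theorem exists_value_eq {f : F → ℂ} (hf : f ∈ polyFun F) : ∃ G, value G = f := by
  rw [polyFun_eq_range] at hf
  obtain ⟨G, rfl⟩ := hf
  exact ⟨G, (funext (aeval_apply_eq_value G)).symm⟩

theorem comp_mem_polyFun {f : F' → ℂ} (hf : f ∈ polyFun F') {g : F → F'}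
    (hg : ∀ φ : Module.Dual ℂ F', (fun v => φ (g v)) ∈ polyFun F) :
    (fun v => f (g v)) ∈ polyFun F := by
  induction hf using Algebra.adjoin_induction with
  | mem f hf =>
    obtain ⟨φ, rfl⟩ := hf
    exact hg φ
  | algebraMap r => exact const_mem_polyFun r
  | add f f' _ _ h h' => exact add_mem h h'
  | mul f f' _ _ h h' => exact mul_mem h h'

theorem comp_linear_mem_polyFun {f : F' → ℂ} (hf : f ∈ polyFun F') (g : F →ₗ[ℂ] F') :
    (fun v => f (g v)) ∈ polyFun F :=
  comp_mem_polyFun hf fun φ => dual_mem_polyFun (φ ∘ₗ g)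

theorem exists_polynomial_eval_line {f : F → ℂ} (hf : f ∈ polyFun F) (a b : F) :
    ∃ p : Polynomial ℂ, ∀ t, f (a + t • b) = p.eval t := by
  induction hf using Algebra.adjoin_induction with
  | mem f hf =>
    obtain ⟨φ, rfl⟩ := hf
    exact ⟨Polynomial.C (φ a) + Polynomial.X * Polynomial.C (φ b), fun t => by simp [mul_comm t]⟩
  | algebraMap r => exact ⟨Polynomial.C r, fun t => by simp⟩
  | add f f' _ _ h h' =>
    obtain ⟨p, hp⟩ := h
    obtain ⟨p', hp'⟩ := h'
    exact ⟨p + p', fun t => by simp [hp, hp']⟩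
  | mul f f' _ _ h h' =>
    obtain ⟨p, hp⟩ := h
    obtain ⟨p', hp'⟩ := h'
    exact ⟨p * p', fun t => by simp [hp, hp']⟩

/-- A polynomial function that does not vanish at a point of an affine line has a non-zero value
at a point of the line different from a given one. -/
theorem exists_ne_zero_line {f : F → ℂ} (hf : f ∈ polyFun F) (a b : F) (t₀ s : ℂ)
    (h : f (a + t₀ • b) ≠ 0) : ∃ t, t ≠ s ∧ f (a + t • b) ≠ 0 := by
  obtain ⟨p, hp⟩ := exists_polynomial_eval_line hf a b
  by_contra! hcon
  have h0 : (Polynomial.X - Polynomial.C s) * p = 0 := Polynomial.funext fun t => by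
    by_cases hts : t = s
    · simp [hts]
    · rw [Polynomial.eval_mul, ← hp, hcon t hts, mul_zero, Polynomial.eval_zero]
  rcases mul_eq_zero.1 h0 with h1 | h1
  · exact Polynomial.X_sub_C_ne_zero s h1
  · rw [hp, h1] at h
    simp at h

theorem polyFun_mul_eq_zero_line {f g : F → ℂ} (hf : f ∈ polyFun F) (hg : g ∈ polyFun F) (a b : F)
    (h : ∀ t : ℂ, f (a + t • b) * g (a + t • b) = 0) :
    (∀ t : ℂ, f (a + t • b) = 0) ∨ (∀ t : ℂ, g (a + t • b) = 0) := by
  obtain ⟨p, hp⟩ := exists_polynomial_eval_line hf a b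
  obtain ⟨q, hq⟩ := exists_polynomial_eval_line hg a b
  have h0 : p * q = 0 := Polynomial.funext fun t => by
    rw [Polynomial.eval_mul, ← hp, ← hq, h, Polynomial.eval_zero]
  rcases mul_eq_zero.1 h0 with h1 | h1
  · exact Or.inl fun t => by rw [hp, h1, Polynomial.eval_zero]
  · exact Or.inr fun t => by rw [hq, h1, Polynomial.eval_zero]

/-- On the line joining a point where `f` is non-zero to one where `g` is, both become polynomials
in one variable. -/
instance : IsDomain (polyFun F) := by
  have : NoZeroDivisors (polyFun F) := by
    refine ⟨fun {f g} hfg => ?_⟩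
    by_contra! hcon
    have hcon' : (f : F → ℂ) ≠ 0 ∧ (g : F → ℂ) ≠ 0 := by simpa using hcon
    obtain ⟨a, ha⟩ := Function.ne_iff.1 hcon'.1
    obtain ⟨b, hb⟩ := Function.ne_iff.1 hcon'.2
    rcases polyFun_mul_eq_zero_line f.2 g.2 a (b - a) fun t =>
      congrFun (congrArg Subtype.val hfg) _ with h | h
    · exact ha (by simpa using h 0)
    · exact hb (by simpa using h 1)
  exact NoZeroDivisors.to_isDomain _

open Classical in
theorem fg_polyFun [Module.Finite ℂ F] : (polyFun F).FG := by
  let b := Module.finBasis ℂ (Module.Dual ℂ F)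
  refine ⟨Finset.univ.image fun i => (b i : F → ℂ), le_antisymm ?_ ?_⟩
  · refine Algebra.adjoin_mono ?_
    intro f hf
    obtain ⟨i, -, rfl⟩ := Finset.mem_image.1 (Finset.mem_coe.1 hf)
    exact ⟨b i, rfl⟩
  · refine Algebra.adjoin_le ?_
    rintro _ ⟨φ, rfl⟩
    have h : (φ : F → ℂ) = ∑ i, b.repr φ i • (b i : F → ℂ) := by
      ext v
      conv_lhs => rw [← b.sum_repr φ, LinearMap.sum_apply]
      simp
    rw [SetLike.mem_coe]
    beta_reduce
    rw [h]
    exact sum_mem fun i _ => Subalgebra.smul_mem _ (Algebra.subset_adjoin (by simp)) _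

instance [Module.Finite ℂ F] : Algebra.FiniteType ℂ (polyFun F) :=
  (Subalgebra.fg_iff_finiteType _).1 fg_polyFun

/-- Irreducibility of a set with respect to polynomial functions. -/
def IsPolyIrreducible (Γ : Set F) : Prop :=
  Γ.Nonempty ∧ ∀ f ∈ polyFun F, ∀ g ∈ polyFun F, (∀ x ∈ Γ, f x * g x = 0) →
    (∀ x ∈ Γ, f x = 0) ∨ (∀ x ∈ Γ, g x = 0)

/-- Zariski closedness in a vector space. -/
def IsPolyClosed (Γ : Set F) : Prop :=
  ∀ x, (∀ f ∈ polyFun F, (∀ y ∈ Γ, f y = 0) → f x = 0) → x ∈ Γ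

theorem IsPolyIrreducible.prod {Γ : Set F} {Γ' : Set F'} (h : IsPolyIrreducible Γ)
    (h' : IsPolyIrreducible Γ') : IsPolyIrreducible (Γ ×ˢ Γ') := by
  have hl : ∀ f ∈ polyFun (F × F'), ∀ y, (fun x => f (x, y)) ∈ polyFun F := fun f hf y =>
    comp_mem_polyFun hf fun φ => by
      have : (fun x => φ (x, y)) = fun x => φ (x, 0) + φ (0, y) := by
        ext x
        rw [← map_add]
        simp
      rw [this]
      exact add_mem (dual_mem_polyFun (φ ∘ₗ LinearMap.inl ℂ F F')) (const_mem_polyFun _)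
  have hr : ∀ f ∈ polyFun (F × F'), ∀ x, (fun y => f (x, y)) ∈ polyFun F' := fun f hf x =>
    comp_mem_polyFun hf fun φ => by
      have : (fun y => φ (x, y)) = fun y => φ (x, 0) + φ (0, y) := by
        ext y
        rw [← map_add]
        simp
      rw [this]
      exact add_mem (const_mem_polyFun _) (dual_mem_polyFun (φ ∘ₗ LinearMap.inr ℂ F F'))
  refine ⟨h.1.prod h'.1, fun f hf g hg hfg => ?_⟩
  by_contra! hcon
  obtain ⟨⟨⟨x₁, y₁⟩, ⟨hx₁, hy₁⟩, h₁⟩, ⟨x₂, y₂⟩, ⟨hx₂, hy₂⟩, h₂⟩ := hcon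
  -- Irreducibility of `Γ` yields one `x` serving both `f (·, y₁)` and `g (·, y₂)`; irreducibility
  -- of `Γ'` is then applied over that `x`.
  have key : ¬ ∀ x ∈ Γ, f (x, y₁) * g (x, y₂) = 0 := fun h0 => by
    rcases h.2 _ (hl f hf y₁) _ (hl g hg y₂) h0 with h3 | h3
    · exact h₁ (h3 x₁ hx₁)
    · exact h₂ (h3 x₂ hx₂)
  push Not at key
  obtain ⟨x, hx, hne⟩ := key
  rcases h'.2 _ (hr f hf x) _ (hr g hg x) fun y hy => hfg (x, y) ⟨hx, hy⟩ with h3 | h3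
  · exact left_ne_zero_of_mul hne (h3 y₁ hy₁)
  · exact right_ne_zero_of_mul hne (h3 y₂ hy₂)

theorem IsPolyClosed.prod {Γ : Set F} {Γ' : Set F'} (h : IsPolyClosed Γ)
    (h' : IsPolyClosed Γ') : IsPolyClosed (Γ ×ˢ Γ') := fun x hx =>
  ⟨h x.1 fun _ hf hΓ => hx _ (comp_linear_mem_polyFun hf (LinearMap.fst ℂ F F'))
      fun y hy => hΓ y.1 hy.1,
    h' x.2 fun _ hf hΓ => hx _ (comp_linear_mem_polyFun hf (LinearMap.snd ℂ F F'))
      fun y hy => hΓ y.2 hy.2⟩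

/-- Restriction of functions to a subset. -/
def restrictHom (Γ : Set F) : (F → ℂ) →ₐ[ℂ] (Γ → ℂ) where
  toFun f x := f x
  map_one' := rfl
  map_mul' _ _ := rfl
  map_zero' := rfl
  map_add' _ _ := rfl
  commutes' _ := rfl

/-- The coordinate ring of a subset of a vector space. -/
def coordRing (Γ : Set F) : Subalgebra ℂ (Γ → ℂ) := (polyFun F).map (restrictHom Γ)

/-- The restriction of polynomial functions to a subset. -/
def polyRestrict (Γ : Set F) : polyFun F →ₐ[ℂ] coordRing Γ :=
  ((restrictHom Γ).comp (polyFun F).val).codRestrict _ fun f => ⟨f, f.2, rfl⟩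

theorem polyRestrict_surjective (Γ : Set F) : Function.Surjective (polyRestrict Γ) := by
  rintro ⟨_, f, hf, rfl⟩
  exact ⟨⟨f, hf⟩, rfl⟩

theorem polyRestrict_eq_zero_iff (Γ : Set F) (f : polyFun F) :
    polyRestrict Γ f = 0 ↔ ∀ x ∈ Γ, (f : F → ℂ) x = 0 := by
  constructor
  · intro h x hx
    exact congrFun (congrArg Subtype.val h) ⟨x, hx⟩
  · intro h
    ext x
    exact h x x.2

instance [Module.Finite ℂ F] (Γ : Set F) : Algebra.FiniteType ℂ (coordRing Γ) :=
  Algebra.FiniteType.of_surjective (polyRestrict Γ) (polyRestrict_surjective Γ)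

theorem IsPolyIrreducible.isDomain_coordRing {Γ : Set F} (h : IsPolyIrreducible Γ) :
    IsDomain (coordRing Γ) := by
  have : Nontrivial (coordRing Γ) := by
    obtain ⟨x, hx⟩ := h.1
    refine ⟨0, 1, fun h0 => ?_⟩
    exact zero_ne_one (congrFun (congrArg Subtype.val h0) ⟨x, hx⟩ : (0 : ℂ) = 1)
  have : NoZeroDivisors (coordRing Γ) := by
    refine ⟨fun {f g} hfg => ?_⟩
    obtain ⟨f, rfl⟩ := polyRestrict_surjective Γ f
    obtain ⟨g, rfl⟩ := polyRestrict_surjective Γ g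
    rw [← map_mul] at hfg
    simp only [polyRestrict_eq_zero_iff] at hfg ⊢
    exact h.2 f f.2 g g.2 hfg
  exact NoZeroDivisors.to_isDomain _

/-- A complex point of the coordinate ring restricts to a linear functional on the dual space, that
is, to evaluation at a vector, which lies in `Γ` by closedness. -/
theorem IsPolyClosed.exists_point [Module.Finite ℂ F] {Γ : Set F} (h : IsPolyClosed Γ)
    (ψ : coordRing Γ →ₐ[ℂ] ℂ) :
    ∃ x ∈ Γ, ∀ f : polyFun F, ψ (polyRestrict Γ f) = (f : F → ℂ) x := by
  let l : Module.Dual ℂ (Module.Dual ℂ F) :=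
    { toFun φ := ψ (polyRestrict Γ ⟨φ, dual_mem_polyFun φ⟩)
      map_add' φ φ' := by
        rw [← map_add, ← map_add]
        rfl
      map_smul' a φ := by
        rw [RingHom.id_apply, ← map_smul, ← map_smul]
        rfl }
  obtain ⟨x, hx⟩ := (Module.evalEquiv ℂ F).surjective l
  have key : ∀ f (hf : f ∈ polyFun F), ψ (polyRestrict Γ ⟨f, hf⟩) = f x := by
    intro f hf
    induction hf using Algebra.adjoin_induction with
    | mem f hf =>
      obtain ⟨φ, rfl⟩ := hf
      exact (LinearMap.congr_fun hx φ).symm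
    | algebraMap r => exact (ψ.comp (polyRestrict Γ)).commutes r
    | add f f' hf hf' h h' =>
      have : (⟨f + f', add_mem hf hf'⟩ : polyFun F) = ⟨f, hf⟩ + ⟨f', hf'⟩ := rfl
      erw [this]
      rw [map_add, map_add]
      exact congrArg₂ _ h h'
    | mul f f' hf hf' h h' =>
      have : (⟨f * f', mul_mem hf hf'⟩ : polyFun F) = ⟨f, hf⟩ * ⟨f', hf'⟩ := rfl
      erw [this]
      rw [map_mul, map_mul]
      exact congrArg₂ _ h h'
  refine ⟨x, h x fun f hf hΓ => ?_, fun f => key f f.2⟩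
  rw [← key f hf, (polyRestrict_eq_zero_iff Γ ⟨f, hf⟩).2 hΓ, map_zero]

end PolyFun

/-! ### Dominant maps from an affine variety to a vector space. -/

section Dominant

variable {F F' : Type u} [AddCommGroup F] [Module ℂ F] [AddCommGroup F'] [Module ℂ F']

/-- Pull-back of polynomial functions along a linear map. -/
def polyComap (q : F →ₗ[ℂ] F') : polyFun F' →ₐ[ℂ] polyFun F where
  toFun f := ⟨fun v => (f : F' → ℂ) (q v), comp_linear_mem_polyFun f.2 q⟩
  map_one' := rfl
  map_mul' _ _ := rfl
  map_zero' := rfl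
  map_add' _ _ := rfl
  commutes' _ := rfl

theorem injective_polyRestrict_comp_polyComap {Γ : Set F} {q : F →ₗ[ℂ] F'}
    (hq : ∀ f ∈ polyFun F', (∀ x ∈ Γ, f (q x) = 0) → f = 0) :
    Function.Injective ((polyRestrict Γ).comp (polyComap q)) := by
  rw [injective_iff_map_eq_zero]
  intro f hf
  exact Subtype.ext (hq f f.2 ((polyRestrict_eq_zero_iff Γ (polyComap q f)).1 hf))

/-- Geometric form of `exists_ne_zero_forall_exists_extension`; the hypothesis `hq` expresses that
`q` restricted to `Γ` is dominant. -/
theorem exists_open_subset_image [Module.Finite ℂ F] [Module.Finite ℂ F'] {Γ : Set F}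
    (hi : IsPolyIrreducible Γ) (hc : IsPolyClosed Γ) (q : F →ₗ[ℂ] F')
    (hq : ∀ f ∈ polyFun F', (∀ x ∈ Γ, f (q x) = 0) → f = 0) {b : F → ℂ} (hb : b ∈ polyFun F)
    (hb0 : ∃ x ∈ Γ, b x ≠ 0) :
    ∃ c ∈ polyFun F', c ≠ 0 ∧ ∀ v, c v ≠ 0 → ∃ x ∈ Γ, q x = v ∧ b x ≠ 0 := by
  have := hi.isDomain_coordRing
  obtain ⟨c, hc0, h⟩ := exists_ne_zero_forall_exists_extension _
    (injective_polyRestrict_comp_polyComap hq) (polyRestrict Γ ⟨b, hb⟩) (by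
      rw [Ne, polyRestrict_eq_zero_iff]
      push Not
      exact hb0)
  refine ⟨c, c.2, fun h0 => hc0 (Subtype.ext h0), fun v hv => ?_⟩
  obtain ⟨ψ, hψ, hψb⟩ := h ((Pi.evalAlgHom ℂ (fun _ : F' => ℂ) v).comp (polyFun F').val) hv
  obtain ⟨x, hx, hxψ⟩ := hc.exists_point ψ
  rw [hxψ] at hψb
  refine ⟨x, hx, ?_, hψb⟩
  rw [← sub_eq_zero, ← Module.forall_dual_apply_eq_zero_iff ℂ]
  intro φ
  have h1 := AlgHom.congr_fun hψ ⟨φ, dual_mem_polyFun φ⟩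
  have h2 := hxψ (polyComap q ⟨φ, dual_mem_polyFun φ⟩)
  have h3 : φ (q x) = φ v := h2.symm.trans h1
  rw [map_sub, h3, sub_self]

/-- Geometric form of `exists_mul_eq_of_forall_algHom_eq`: `a` descends to the rational function `e
/ d` on the target. -/
theorem exists_mul_eq_comp [Module.Finite ℂ F] {Γ : Set F}
    (hi : IsPolyIrreducible Γ) (hc : IsPolyClosed Γ) (q : F →ₗ[ℂ] F')
    (hq : ∀ f ∈ polyFun F', (∀ x ∈ Γ, f (q x) = 0) → f = 0) {a : F → ℂ} (ha : a ∈ polyFun F)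
    {c : F' → ℂ} (hcp : c ∈ polyFun F') (hc0 : c ≠ 0)
    (h : ∀ x ∈ Γ, ∀ y ∈ Γ, q x = q y → c (q x) ≠ 0 → a x = a y) :
    ∃ d ∈ polyFun F', ∃ e ∈ polyFun F', d ≠ 0 ∧ ∀ x ∈ Γ, d (q x) * a x = e (q x) := by
  have := hi.isDomain_coordRing
  obtain ⟨d, e, hd, hde⟩ := exists_mul_eq_of_forall_algHom_eq _
    (injective_polyRestrict_comp_polyComap hq) (polyRestrict Γ ⟨a, ha⟩) ⟨c, hcp⟩
    (fun h0 => hc0 (congrArg Subtype.val h0)) (by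
      intro ψ₁ ψ₂ h12 h1
      obtain ⟨x, hx, hxψ⟩ := hc.exists_point ψ₁
      obtain ⟨y, hy, hyψ⟩ := hc.exists_point ψ₂
      rw [hxψ, hyψ]
      refine h x hx y hy ?_ ?_
      · rw [← sub_eq_zero, ← Module.forall_dual_apply_eq_zero_iff ℂ]
        intro φ
        have h3 := AlgHom.congr_fun h12 ⟨φ, dual_mem_polyFun φ⟩
        simp only [AlgHom.comp_apply, hxψ, hyψ] at h3
        rw [map_sub, sub_eq_zero]
        exact h3
      · rw [AlgHom.comp_apply, hxψ] at h1
        exact h1)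
  exact ⟨d, d.2, e, e.2, fun h0 => hd (Subtype.ext h0), fun x hx =>
    congrFun (congrArg Subtype.val hde) ⟨x, hx⟩⟩

end Dominant

/-! ### Dictionary between closed subsets of projective space and their affine cones. -/

section Dictionary

variable {E : Type*} [AddCommGroup E] [Module ℂ E]

theorem value_smul {F : MvPolynomial (Module.Dual ℂ E) ℂ} {d : ℕ} (hF : F.IsHomogeneous d)
    (t : ℂ) (v : E) : value F (t • v) = t ^ d * value F v := by
  simp only [value, MvPolynomial.eval_eq, Finset.mul_sum]
  refine Finset.sum_congr rfl fun m hm => ?_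
  have hd : ∑ i ∈ m.support, m i = d := by
    rw [← hF.degree_eq_sum_deg_support hm]
  simp only [map_smul, smul_eq_mul, mul_pow, Finset.prod_mul_distrib, Finset.prod_pow_eq_pow_sum,
    hd]
  ring

theorem exists_rep_eq_smul {v : E} (hv : v ≠ 0) :
    ∃ a : ℂ, a ≠ 0 ∧ (Projectivization.mk ℂ v hv).rep = a • v := by
  obtain ⟨a, ha⟩ := Projectivization.exists_smul_eq_mk_rep ℂ v hv
  exact ⟨a, a.ne_zero, ha.symm⟩

theorem value_rep_mk_eq_zero_iff {F : MvPolynomial (Module.Dual ℂ E) ℂ} {d : ℕ}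
    (hF : F.IsHomogeneous d) {v : E} (hv : v ≠ 0) :
    value F (Projectivization.mk ℂ v hv).rep = 0 ↔ value F v = 0 := by
  obtain ⟨a, ha, h⟩ := exists_rep_eq_smul hv
  rw [h, value_smul hF]
  simp [ha]

theorem isClosed_iff_isZariskiClosed (Z : Set (ℙ ℂ E)) : IsClosed Z ↔ IsZariskiClosed Z := by
  rw [← isOpen_compl_iff]
  change IsZariskiClosed Zᶜᶜ ↔ _
  rw [compl_compl]

theorem value_eq_sum_homogeneousComponent (G : MvPolynomial (Module.Dual ℂ E) ℂ) (v : E) :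
    value G v = ∑ i ∈ Finset.range (G.totalDegree + 1), value (G.homogeneousComponent i) v := by
  conv_lhs => rw [← MvPolynomial.sum_homogeneousComponent G]
  simp only [value, map_sum]

/-- If a polynomial function vanishes on a line through the origin then so do its homogeneous
components. -/
theorem value_homogeneousComponent_eq_zero {G : MvPolynomial (Module.Dual ℂ E) ℂ} {v : E}
    (h : ∀ t : ℂ, value G (t • v) = 0) (i : ℕ) : value (G.homogeneousComponent i) v = 0 := by
  have hp : (∑ i ∈ Finset.range (G.totalDegree + 1),
      Polynomial.monomial i (value (G.homogeneousComponent i) v)) = 0 :=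
    Polynomial.funext fun t => by
      rw [Polynomial.eval_zero, ← h t, value_eq_sum_homogeneousComponent,
        Polynomial.eval_finsetSum]
      refine Finset.sum_congr rfl fun i _ => ?_
      rw [value_smul (MvPolynomial.homogeneousComponent_isHomogeneous i G),
        Polynomial.eval_monomial, mul_comm]
  by_cases hi : i < G.totalDegree + 1
  · have := congrArg (fun p => p.coeff i) hp
    simpa [Polynomial.finsetSum_coeff, Polynomial.coeff_monomial, hi] using this
  · rw [MvPolynomial.homogeneousComponent_eq_zero _ _ (by omega)]
    simp [value]

/-- The points of `ℙ(E)` on which a function on `E` vanishes identically. -/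
def lineZeros (f : E → ℂ) : Set (ℙ ℂ E) := {p | ∀ t : ℂ, f (t • p.rep) = 0}

theorem mk_mem_lineZeros {f : E → ℂ} {v : E} (hv : v ≠ 0) :
    Projectivization.mk ℂ v hv ∈ lineZeros f ↔ ∀ t : ℂ, f (t • v) = 0 := by
  obtain ⟨a, ha, h⟩ := exists_rep_eq_smul hv
  simp only [lineZeros, Set.mem_ofPred_eq, h, smul_smul]
  constructor
  · intro h0 t
    have := h0 (t * a⁻¹)
    rwa [mul_assoc, inv_mul_cancel₀ ha, mul_one] at this
  · intro h0 t
    exact h0 _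

theorem isClosed_lineZeros {f : E → ℂ} (hf : f ∈ polyFun E) : IsClosed (lineZeros f) := by
  obtain ⟨G, rfl⟩ := exists_value_eq hf
  rw [isClosed_iff_isZariskiClosed]
  refine ⟨Set.range fun i => G.homogeneousComponent i, ?_, ?_⟩
  · rintro _ ⟨i, rfl⟩
    exact ⟨i, MvPolynomial.homogeneousComponent_isHomogeneous i G⟩
  · ext p
    constructor
    · rintro hp _ ⟨i, rfl⟩
      exact value_homogeneousComponent_eq_zero hp i
    · intro hp t
      rw [value_eq_sum_homogeneousComponent]
      refine Finset.sum_eq_zero fun i _ => ?_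
      rw [value_smul (MvPolynomial.homogeneousComponent_isHomogeneous i G), hp _ ⟨i, rfl⟩,
        mul_zero]

/-- The points of `ℙ(E)` on which a polynomial function does not vanish identically form a
nonempty open set. -/
theorem nonempty_compl_lineZeros [Nontrivial E] {f : E → ℂ} (hf : f ≠ 0) :
    (lineZeros f)ᶜ.Nonempty := by
  obtain ⟨v, hv⟩ := Function.ne_iff.1 hf
  obtain ⟨u, hu, t, rfl⟩ : ∃ u : E, u ≠ 0 ∧ ∃ t : ℂ, v = t • u := by
    by_cases h0 : v = 0
    · obtain ⟨u, hu⟩ := exists_ne (0 : E)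
      exact ⟨u, hu, 0, by simp [h0]⟩
    · exact ⟨v, h0, 1, by simp⟩
  exact ⟨Projectivization.mk ℂ u hu, fun h => hv ((mk_mem_lineZeros hu).1 h t)⟩

theorem exists_rep_of_notMem_lineZeros {f : E → ℂ} (hf : f ∈ polyFun E) {p : ℙ ℂ E}
    (hp : p ∉ lineZeros f) :
    ∃ (v : E) (hv : v ≠ 0), p = Projectivization.mk ℂ v hv ∧ f v ≠ 0 := by
  simp only [lineZeros, Set.mem_ofPred_eq, not_forall] at hp
  obtain ⟨t₀, h⟩ := hp
  -- As `f` need not be homogeneous, the known non-zero value may be at the origin; another point of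
  -- the same line is needed.
  obtain ⟨t, ht, h0⟩ := exists_ne_zero_line hf 0 p.rep t₀ 0 (by rwa [zero_add])
  rw [zero_add] at h0
  refine ⟨t • p.rep, smul_ne_zero ht p.rep_nonzero, ?_, h0⟩
  conv_lhs => rw [← p.mk_rep]
  rw [Projectivization.mk_eq_mk_iff']
  exact ⟨t⁻¹, by rw [smul_smul, inv_mul_cancel₀ ht, one_smul]⟩

/-- An open neighbourhood of a point contains the locus where a polynomial function does not
vanish. -/
theorem exists_polyFun_of_isOpen {U : Set (ℙ ℂ E)} (hU : IsOpen U) {p : ℙ ℂ E} (hp : p ∈ U) :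
    ∃ f ∈ polyFun E, f p.rep ≠ 0 ∧ ∀ (v : E) (hv : v ≠ 0), f v ≠ 0 →
      Projectivization.mk ℂ v hv ∈ U := by
  have hc : IsZariskiClosed Uᶜ := (isClosed_iff_isZariskiClosed _).1 hU.isClosed_compl
  obtain ⟨S, hS, hUS⟩ := hc
  have hpS : p ∉ zeroLocus S := by
    rw [← hUS]
    exact fun h => h hp
  simp only [zeroLocus, Set.mem_ofPred_eq, not_forall] at hpS
  obtain ⟨G, hG, hGp⟩ := hpS
  refine ⟨value G, value_mem_polyFun G, hGp, fun v hv h => ?_⟩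
  by_contra hcon
  have hz : Projectivization.mk ℂ v hv ∈ zeroLocus S := by
    rw [← hUS]
    exact hcon
  obtain ⟨d, hd⟩ := hS G hG
  exact h ((value_rep_mk_eq_zero_iff hd hv).1 (hz G hG))

/-- The cone in `E` over a subset of `ℙ(E)`. -/
def affineCone (X : Set (ℙ ℂ E)) : Set E :=
  {v | ∀ hv : v ≠ 0, Projectivization.mk ℂ v hv ∈ X}

theorem smul_mem_affineCone {X : Set (ℙ ℂ E)} {v : E} (hv : v ∈ affineCone X) (t : ℂ) :
    t • v ∈ affineCone X := fun ht => by
  have hv0 : v ≠ 0 := right_ne_zero_of_smul ht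
  have : Projectivization.mk ℂ (t • v) ht = Projectivization.mk ℂ v hv0 :=
    (Projectivization.mk_eq_mk_iff' _ _ _ _ _).2 ⟨t, rfl⟩
  rw [this]
  exact hv hv0

theorem rep_mem_affineCone {X : Set (ℙ ℂ E)} {p : ℙ ℂ E} (hp : p ∈ X) :
    p.rep ∈ affineCone X := fun _ => by rwa [p.mk_rep]

theorem mem_affineCone_of_mem_submodule {X : Set (ℙ ℂ E)} {p : ℙ ℂ E} (hp : p ∈ X) {v : E}
    (hv : v ∈ p.submodule) : v ∈ affineCone X := by
  rw [p.submodule_eq, Submodule.mem_span_singleton] at hv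
  obtain ⟨t, rfl⟩ := hv
  exact smul_mem_affineCone (rep_mem_affineCone hp) t

theorem isPolyClosed_affineCone {X : Set (ℙ ℂ E)} (hX : IsClosed X) (hne : X.Nonempty) :
    IsPolyClosed (affineCone X) := by
  rw [isClosed_iff_isZariskiClosed] at hX
  obtain ⟨S, hS, rfl⟩ := hX
  obtain ⟨p, hp⟩ := hne
  intro v hv hv0 G hG
  obtain ⟨d, hd⟩ := hS G hG
  rw [value_rep_mk_eq_zero_iff hd hv0]
  refine hv _ (value_mem_polyFun G) fun y hy => ?_
  by_cases hy0 : y = 0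
  -- The origin is in the cone without representing a point. Writing it as `0 • p.rep` with `p ∈ X`
  -- also covers degree zero, where `X` must be nonempty.
  · rw [hy0, ← zero_smul ℂ p.rep, value_smul hd, hp G hG, mul_zero]
  · exact (value_rep_mk_eq_zero_iff hd hy0).1 (hy hy0 G hG)

theorem forall_affineCone_eq_zero {X : Set (ℙ ℂ E)} (hne : X.Nonempty) {f : E → ℂ}
    (h : X ⊆ lineZeros f) : ∀ v ∈ affineCone X, f v = 0 := by
  intro v hv
  by_cases hv0 : v = 0
  · obtain ⟨p, hp⟩ := hne
    have := h hp 0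
    rwa [zero_smul, ← hv0] at this
  · simpa using (mk_mem_lineZeros hv0).1 (h (hv hv0)) 1

/-- On each line through the origin one factor vanishes identically, so `X` is covered by two closed
sets `lineZeros`. -/
theorem isPolyIrreducible_affineCone {X : Set (ℙ ℂ E)} (hX : IsIrreducible X) :
    IsPolyIrreducible (affineCone X) := by
  refine ⟨⟨0, fun h => absurd rfl h⟩, fun f hf g hg hfg => ?_⟩
  have hsub : X ⊆ lineZeros f ∪ lineZeros g := fun p hp => by
    rcases polyFun_mul_eq_zero_line hf hg 0 p.rep (fun t => by
      rw [zero_add]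
      exact hfg _ (smul_mem_affineCone (rep_mem_affineCone hp) t)) with h | h
    · exact Or.inl fun t => by simpa using h t
    · exact Or.inr fun t => by simpa using h t
  rcases isPreirreducible_iff_isClosed_union_isClosed.1 hX.2 _ _ (isClosed_lineZeros hf)
    (isClosed_lineZeros hg) hsub with h | h
  · exact Or.inl (forall_affineCone_eq_zero hX.1 h)
  · exact Or.inr (forall_affineCone_eq_zero hX.1 h)

end Dictionary

/-! ### Bivectors, contraction and Plücker coordinates of lines. -/

section Wedge

variable {E : Type*} [AddCommGroup E] [Module ℂ E]

/-- The exterior product of two vectors. -/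
noncomputable def wedge : E →ₗ[ℂ] E →ₗ[ℂ] ⋀[ℂ]^2 E :=
  LinearMap.mk₂ ℂ (fun x y => exteriorPower.ιMulti ℂ 2 ![x, y])
    (fun x x' y => by
      have := (exteriorPower.ιMulti ℂ 2).map_update_add ![x, y] 0 x x'
      have h : ∀ z, Function.update ![x, y] 0 z = ![z, y] := fun z => by
        ext i; fin_cases i <;> simp
      simpa only [h] using this)
    (fun a x y => by
      have := (exteriorPower.ιMulti ℂ 2).map_update_smul ![x, y] 0 a x
      have h : ∀ z, Function.update ![x, y] 0 z = ![z, y] := fun z => by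
        ext i; fin_cases i <;> simp
      simpa only [h] using this)
    (fun x y y' => by
      have := (exteriorPower.ιMulti ℂ 2).map_update_add ![x, y] 1 y y'
      have h : ∀ z, Function.update ![x, y] 1 z = ![x, z] := fun z => by
        ext i; fin_cases i <;> simp
      simpa only [h] using this)
    (fun a x y => by
      have := (exteriorPower.ιMulti ℂ 2).map_update_smul ![x, y] 1 a y
      have h : ∀ z, Function.update ![x, y] 1 z = ![x, z] := fun z => by
        ext i; fin_cases i <;> simp
      simpa only [h] using this)

theorem wedge_apply (x y : E) : wedge x y = exteriorPower.ιMulti ℂ 2 ![x, y] := rfl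

theorem wedge_self (x : E) : wedge x x = 0 :=
  (exteriorPower.ιMulti ℂ 2).map_eq_zero_of_eq ![x, x] (i := 0) (j := 1) rfl (by decide)

theorem wedge_swap (x y : E) : wedge y x = -wedge x y := by
  have h := wedge_self (x + y)
  simp only [map_add, LinearMap.add_apply, wedge_self, zero_add, add_zero] at h
  exact eq_neg_of_add_eq_zero_left h

/-- Contraction of a bivector with a linear form. -/
noncomputable def contract (φ : Module.Dual ℂ E) : ⋀[ℂ]^2 E →ₗ[ℂ] E :=
  exteriorPower.alternatingMapLinearEquiv
    { toFun m := φ (m 0) • m 1 - φ (m 1) • m 0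
      map_update_add' m i x y := by
        fin_cases i <;> simp [add_smul] <;> abel
      map_update_smul' m i a x := by
        fin_cases i <;> simp [smul_sub, smul_smul, mul_comm]
      map_eq_zero_of_eq' m i j h hij := by
        fin_cases i <;> fin_cases j <;> simp_all }

theorem contract_wedge (φ : Module.Dual ℂ E) (x y : E) :
    contract φ (wedge x y) = φ x • y - φ y • x := by
  rw [wedge_apply, contract, exteriorPower.alternatingMapLinearEquiv_apply_ιMulti]
  simp

theorem linearIndependent_pair_of_wedge_ne_zero {x y : E} (h : wedge x y ≠ 0) :
    LinearIndependent ℂ ![x, y] := by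
  rw [LinearIndependent.pair_iff]
  intro s t hst
  have h1 : wedge x (s • x + t • y) = 0 := by rw [hst, map_zero]
  have h2 : wedge (s • x + t • y) y = 0 := by rw [hst, map_zero, LinearMap.zero_apply]
  simp only [map_add, map_smul, LinearMap.add_apply, LinearMap.smul_apply, wedge_self, smul_zero,
    zero_add, add_zero, smul_eq_zero, h, or_false] at h1 h2
  exact ⟨h2, h1⟩

theorem exists_dual_pair {x y : E} (h : LinearIndependent ℂ ![x, y]) (a b : ℂ) :
    ∃ φ : Module.Dual ℂ E, φ x = a ∧ φ y = b := by
  obtain ⟨φ, hφ⟩ := LinearMap.exists_extend ((Module.Basis.span h).constr ℂ ![a, b])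
  have key : ∀ i, φ (![x, y] i) = ![a, b] i := fun i => by
    have h1 := LinearMap.congr_fun hφ (Module.Basis.span h i)
    rw [Module.Basis.constr_basis, LinearMap.comp_apply, Submodule.subtype_apply,
      Module.Basis.span_apply] at h1
    exact h1
  exact ⟨φ, key 0, key 1⟩

theorem wedge_ne_zero_iff {x y : E} : wedge x y ≠ 0 ↔ LinearIndependent ℂ ![x, y] := by
  refine ⟨linearIndependent_pair_of_wedge_ne_zero, fun h h0 => ?_⟩
  obtain ⟨φ, hx, hy⟩ := exists_dual_pair h 1 0
  have h1 := contract_wedge φ x y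
  rw [h0, map_zero, hx, hy, one_smul, zero_smul, sub_zero] at h1
  exact h.ne_zero 1 h1.symm

/-- With `contract_wedge_mem`, this recovers a line from its Plücker vector: it is the set of all
contractions. -/
theorem exists_contract_wedge_eq {x y v : E} (h : wedge x y ≠ 0)
    (hv : v ∈ Submodule.span ℂ {x, y}) : ∃ φ, contract φ (wedge x y) = v := by
  obtain ⟨a, b, rfl⟩ := Submodule.mem_span_pair.1 hv
  obtain ⟨φ, hx, hy⟩ := exists_dual_pair (wedge_ne_zero_iff.1 h) b (-a)
  exact ⟨φ, by rw [contract_wedge, hx, hy, neg_smul, sub_neg_eq_add, add_comm]⟩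

theorem contract_wedge_mem (φ : Module.Dual ℂ E) (x y : E) :
    contract φ (wedge x y) ∈ Submodule.span ℂ {x, y} := by
  rw [contract_wedge]
  exact sub_mem (Submodule.smul_mem _ _ (Submodule.subset_span (by simp)))
    (Submodule.smul_mem _ _ (Submodule.subset_span (by simp)))

theorem span_pair_le_of_wedge_eq_smul {x y x' y' : E} {s : ℂ} (h : wedge x y ≠ 0)
    (hs : wedge x y = s • wedge x' y') :
    Submodule.span ℂ {x, y} ≤ Submodule.span ℂ {x', y'} := by
  intro v hv
  obtain ⟨φ, rfl⟩ := exists_contract_wedge_eq h hv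
  rw [hs, map_smul]
  exact Submodule.smul_mem _ _ (contract_wedge_mem φ x' y')

theorem span_pair_eq_of_wedge_eq_smul {x y x' y' : E} {s : ℂ} (h : wedge x y ≠ 0)
    (hs : wedge x y = s • wedge x' y') :
    Submodule.span ℂ {x, y} = Submodule.span ℂ {x', y'} := by
  have hs0 : s ≠ 0 := fun h0 => h (by rw [hs, h0, zero_smul])
  refine le_antisymm (span_pair_le_of_wedge_eq_smul h hs)
    (span_pair_le_of_wedge_eq_smul (s := s⁻¹) (fun h0 => h (by rw [hs, h0, smul_zero])) ?_)
  rw [hs, smul_smul, inv_mul_cancel₀ hs0, one_smul]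

theorem exists_wedge_eq_smul {x y x' y' : E} (hx : x ∈ Submodule.span ℂ {x', y'})
    (hy : y ∈ Submodule.span ℂ {x', y'}) : ∃ s : ℂ, wedge x y = s • wedge x' y' := by
  obtain ⟨a, b, rfl⟩ := Submodule.mem_span_pair.1 hx
  obtain ⟨c, d, rfl⟩ := Submodule.mem_span_pair.1 hy
  refine ⟨a * d - b * c, ?_⟩
  simp only [map_add, map_smul, LinearMap.add_apply, LinearMap.smul_apply, wedge_self, smul_zero,
    zero_add, add_zero, wedge_swap x' y']
  module

theorem bilinear_mem_polyFun [Module.Finite ℂ E] (B : E →ₗ[ℂ] E →ₗ[ℂ] ℂ) :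
    (fun x : E × E => B x.1 x.2) ∈ polyFun (E × E) := by
  let b := Module.finBasis ℂ E
  have h : (fun x : E × E => B x.1 x.2) =
      ∑ i, (fun x : E × E => b.coord i x.1) * (fun x : E × E => B (b i) x.2) := by
    ext x
    conv_lhs => rw [← b.sum_repr x.1, map_sum, LinearMap.sum_apply]
    simp
  rw [h]
  exact sum_mem fun i _ => mul_mem (dual_mem_polyFun (b.coord i ∘ₗ LinearMap.fst ℂ E E))
    (dual_mem_polyFun (B (b i) ∘ₗ LinearMap.snd ℂ E E))

end Wedge

/-! ### Polynomial consequences of non-defectiveness and of being a secant line. -/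

section Secant

variable {E : Type*} [AddCommGroup E] [Module ℂ E]

/-- The sum of two vectors, as a linear map. -/
def sumMap : E × E →ₗ[ℂ] E := LinearMap.coprod LinearMap.id LinearMap.id

theorem sumMap_apply (x : E × E) : sumMap x = x.1 + x.2 := rfl

/-- Non-defectiveness in affine form: addition from two copies of the cone to `E` is dominant. -/
theorem eq_zero_of_secantVariety_eq_univ [Nontrivial E] {X : Set (ℙ ℂ E)}
    (h : secantVariety X = Set.univ) :
    ∀ f ∈ polyFun E, (∀ x ∈ affineCone X ×ˢ affineCone X, f (sumMap x) = 0) → f = 0 := by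
  intro f hf h0
  by_contra hf0
  obtain ⟨p, hp⟩ := nonempty_compl_lineZeros hf0
  refine hp ?_
  have hsub : secantVariety X ⊆ lineZeros f := by
    refine closure_minimal ?_ (isClosed_lineZeros hf)
    rintro p ⟨L, ⟨x, hx, y, hy, -, rfl⟩, hpL⟩ t
    have hm : t • p.rep ∈ x.submodule ⊔ y.submodule := by
      refine hpL (Submodule.smul_mem _ _ ?_)
      rw [p.submodule_eq]
      exact Submodule.mem_span_singleton_self _
    obtain ⟨a, ha, b, hb, hab⟩ := Submodule.mem_sup.1 hm
    rw [← hab]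
    exact h0 (a, b) ⟨mem_affineCone_of_mem_submodule hx ha, mem_affineCone_of_mem_submodule hy hb⟩
  exact hsub (h ▸ Set.mem_univ p)

/-- The Plücker vectors of all secant lines satisfy the polynomial relations that hold for the
Plücker vectors of the proper secant lines. -/
theorem IsSecantLine.exists_wedge {X : Set (ℙ ℂ E)} {L : Submodule ℂ E} (hL : IsSecantLine X L) :
    ∃ x y, L = Submodule.span ℂ {x, y} ∧ wedge x y ≠ 0 ∧ ∀ G ∈ polyFun (⋀[ℂ]^2 E),
      (∀ z₁ ∈ affineCone X, ∀ z₂ ∈ affineCone X, G (wedge z₁ z₂) = 0) → G (wedge x y) = 0 := by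
  obtain ⟨w, ⟨x, y, hxy, hw⟩, hcl⟩ := hL
  rw [← wedge_apply] at hw
  have hmem : ∀ (w' : ℙ ℂ (⋀[ℂ]^2 E)) (ω : ⋀[ℂ]^2 E), w'.submodule = Submodule.span ℂ {ω} →
      ∃ t : ℂ, t ≠ 0 ∧ ω = t • w'.rep := by
    intro w' ω h
    rw [w'.submodule_eq] at h
    have h1 : w'.rep ∈ Submodule.span ℂ {ω} := h ▸ Submodule.mem_span_singleton_self _
    obtain ⟨s, hs⟩ := Submodule.mem_span_singleton.1 h1
    have hs0 : s ≠ 0 := fun h0 => w'.rep_nonzero (by rw [← hs, h0, zero_smul])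
    exact ⟨s⁻¹, inv_ne_zero hs0, by rw [← hs, smul_smul, inv_mul_cancel₀ hs0, one_smul]⟩
  obtain ⟨t, ht, hwt⟩ := hmem w _ hw
  refine ⟨x, y, hxy, ?_, fun G hG h0 => ?_⟩
  · rw [hwt]
    exact smul_ne_zero ht w.rep_nonzero
  · have hsub : w ∈ lineZeros G := by
      refine closure_minimal ?_ (isClosed_lineZeros hG) hcl
      rintro w' ⟨L', ⟨z₁, hz₁, z₂, hz₂, -, rfl⟩, x', y', hxy', hw'⟩ r
      rw [← wedge_apply] at hw'
      obtain ⟨t', ht', hwt'⟩ := hmem w' _ hw'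
      have hspan : Submodule.span ℂ {x', y'} = Submodule.span ℂ {z₁.rep, z₂.rep} := by
        rw [← hxy', z₁.submodule_eq, z₂.submodule_eq, Submodule.span_insert]
      obtain ⟨s, hs⟩ := exists_wedge_eq_smul (x := x') (y := y') (x' := z₁.rep) (y' := z₂.rep)
        (hspan ▸ Submodule.subset_span (by simp)) (hspan ▸ Submodule.subset_span (by simp))
      have : r • w'.rep = wedge ((r * t'⁻¹ * s) • z₁.rep) z₂.rep := by
        rw [map_smul, LinearMap.smul_apply, mul_smul, ← hs, hwt', smul_smul, mul_assoc,
          inv_mul_cancel₀ ht', mul_one]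
      rw [this]
      exact h0 _ (smul_mem_affineCone (rep_mem_affineCone hz₁) _) _ (rep_mem_affineCone hz₂)
    rw [hwt]
    exact hsub t

end Secant

/-! ### Uniqueness among all secant lines, improper ones included. -/

section UniqueLine

variable {E : Type u} [AddCommGroup E] [Module ℂ E] [Module.Finite ℂ E] [Nontrivial E]

/-- If a general vector is in a unique way a sum of two vectors of the cone over `X`, then there is
a unique secant line, proper or improper, through a general point. -/
theorem exists_unique_secantLine {X : Set (ℙ ℂ E)} (hXc : IsClosed X) (hXi : IsIrreducible X)
    (hXs : secantVariety X = Set.univ) {c : E → ℂ} (hc : c ∈ polyFun E) (hc0 : c ≠ 0)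
    (hind : ∀ x₁ ∈ affineCone X, ∀ x₂ ∈ affineCone X, c (x₁ + x₂) ≠ 0 → wedge x₁ x₂ ≠ 0)
    (huniq : ∀ x₁ ∈ affineCone X, ∀ x₂ ∈ affineCone X, ∀ y₁ ∈ affineCone X, ∀ y₂ ∈ affineCone X,
      x₁ + x₂ = y₁ + y₂ → c (x₁ + x₂) ≠ 0 → (x₁ = y₁ ∧ x₂ = y₂) ∨ (x₁ = y₂ ∧ x₂ = y₁)) :
    ∃ d ∈ polyFun E, d ≠ 0 ∧ ∀ x₁ ∈ affineCone X, ∀ x₂ ∈ affineCone X, d (x₁ + x₂) ≠ 0 →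
      ∀ L, IsSecantLine X L → x₁ + x₂ ∈ L → L = Submodule.span ℂ {x₁, x₂} := by
  set Γ := affineCone X ×ˢ affineCone X with hΓ
  have hi : IsPolyIrreducible Γ :=
    (isPolyIrreducible_affineCone hXi).prod (isPolyIrreducible_affineCone hXi)
  have hcl : IsPolyClosed Γ :=
    (isPolyClosed_affineCone hXc hXi.1).prod (isPolyClosed_affineCone hXc hXi.1)
  have hdom := eq_zero_of_secantVariety_eq_univ hXs
  have hpoly : ∀ α : Module.Dual ℂ (⋀[ℂ]^2 E),
      (fun x : E × E => α (wedge x.1 x.2)) ∈ polyFun (E × E) := fun α =>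
    bilinear_mem_polyFun (wedge.compr₂ α)
  obtain ⟨β, hβ⟩ : ∃ β : Module.Dual ℂ (⋀[ℂ]^2 E), ∃ x ∈ Γ, β (wedge x.1 x.2) ≠ 0 := by
    have : ¬ ∀ x ∈ Γ, c (sumMap x) = 0 := fun h => hc0 (hdom c hc h)
    push Not at this
    obtain ⟨x, hx, hcx⟩ := this
    have hw := hind x.1 hx.1 x.2 hx.2 hcx
    by_contra! hcon
    exact hw ((Module.forall_dual_apply_eq_zero_iff ℂ _).1 fun β => hcon β x hx)
  obtain ⟨c', hc', hc'0, hc'β⟩ := exists_open_subset_image hi hcl sumMap hdom (hpoly β) hβ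
  have hrat : ∀ α : Module.Dual ℂ (⋀[ℂ]^2 E), ∃ d ∈ polyFun E, ∃ e ∈ polyFun E, d ≠ 0 ∧
      ∀ x ∈ Γ, d (sumMap x) * (α (wedge x.1 x.2) * β (wedge x.1 x.2)) = e (sumMap x) := by
    intro α
    -- The bare `α (x₁ ∧ x₂)` changes sign when the summands are swapped; the factor `β` makes it
    -- invariant, so it is constant on the fibres of the sum.
    refine exists_mul_eq_comp hi hcl sumMap hdom (mul_mem (hpoly α) (hpoly β)) hc hc0 ?_
    intro x hx y hy hxy hcx
    rcases huniq x.1 hx.1 x.2 hx.2 y.1 hy.1 y.2 hy.2 hxy hcx with ⟨h1, h2⟩ | ⟨h1, h2⟩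
    · rw [h1, h2]
    · rw [h1, h2, wedge_swap y.1 y.2]
      simp
  choose d hd e he hd0 hde using hrat
  let b := Module.finBasis ℂ (⋀[ℂ]^2 E)
  let D : polyFun E := ⟨c, hc⟩ * ⟨c', hc'⟩ * ⟨d β, hd β⟩ * ∏ k, ⟨d (b.coord k), hd _⟩
  have hsub : ∀ {f : E → ℂ} (hf : f ∈ polyFun E), f ≠ 0 → (⟨f, hf⟩ : polyFun E) ≠ 0 :=
    fun hf h h0 => h (congrArg Subtype.val h0)
  have hD0 : D ≠ 0 := mul_ne_zero (mul_ne_zero (mul_ne_zero (hsub hc hc0) (hsub hc' hc'0))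
    (hsub _ (hd0 β))) (Finset.prod_ne_zero_iff.2 fun k _ => hsub _ (hd0 _))
  refine ⟨D, D.2, fun h => hD0 (Subtype.ext h), fun x₁ hx₁ x₂ hx₂ hDx L hL hvL => ?_⟩
  have hDx' : c (x₁ + x₂) * c' (x₁ + x₂) * d β (x₁ + x₂) * ∏ k, d (b.coord k) (x₁ + x₂) ≠ 0 := by
    convert hDx
    simp [D]
  have hdk : ∀ k, d (b.coord k) (x₁ + x₂) ≠ 0 := fun k =>
    Finset.prod_ne_zero_iff.1 (right_ne_zero_of_mul hDx') k (Finset.mem_univ k)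
  have h3 := left_ne_zero_of_mul hDx'
  have hdβ := right_ne_zero_of_mul h3
  have hcv := left_ne_zero_of_mul (left_ne_zero_of_mul h3)
  -- The function `c'` only provides some decomposition on which `β` is non-zero; uniqueness up to
  -- order transfers this to the given one.
  have hβv : β (wedge x₁ x₂) ≠ 0 := by
    obtain ⟨y, hy, hyv, hyβ⟩ := hc'β _ (right_ne_zero_of_mul (left_ne_zero_of_mul h3))
    rcases huniq x₁ hx₁ x₂ hx₂ y.1 hy.1 y.2 hy.2 hyv.symm hcv with ⟨h1, h2⟩ | ⟨h1, h2⟩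
    · rwa [h1, h2]
    · rw [h1, h2, wedge_swap y.1 y.2, map_neg]
      exact neg_ne_zero.2 hyβ
  obtain ⟨x, y, rfl, hxy, hrel⟩ := hL.exists_wedge
  obtain ⟨φ, hφ⟩ := exists_contract_wedge_eq hxy hvL
  have key : ∀ k, b.coord k (wedge x y) * β (wedge x₁ x₂) =
      b.coord k (wedge x₁ x₂) * β (wedge x y) := by
    intro k
    -- Cross-multiplied form of the proportionality of `αβ = e_α / d_α` and `β² = e_β / d_β`,
    -- evaluated at the contraction by `φ`, for `α` the `k`-th coordinate. It holds for proper
    -- secant lines, hence for `x ∧ y`, whose contraction by `φ` is `x₁ + x₂`.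
    have hG := hrel ((fun w => e (b.coord k) (contract φ w)) * (fun w => d β (contract φ w)) * β -
      (fun w => e β (contract φ w)) * (fun w => d (b.coord k) (contract φ w)) * b.coord k)
      (sub_mem (mul_mem (mul_mem (comp_linear_mem_polyFun (he _) _)
        (comp_linear_mem_polyFun (hd _) _)) (dual_mem_polyFun β))
        (mul_mem (mul_mem (comp_linear_mem_polyFun (he _) _)
        (comp_linear_mem_polyFun (hd _) _)) (dual_mem_polyFun _))) (by
        intro z₁ hz₁ z₂ hz₂
        -- The contraction of `z₁ ∧ z₂` is the sum of these two vectors of the cone, whose wedge is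
        -- a multiple of `z₁ ∧ z₂`.
        have hz : (((-φ z₂) • z₁, φ z₁ • z₂) : E × E) ∈ Γ :=
          ⟨smul_mem_affineCone hz₁ _, smul_mem_affineCone hz₂ _⟩
        have hsum : sumMap (((-φ z₂) • z₁, φ z₁ • z₂) : E × E) = contract φ (wedge z₁ z₂) := by
          rw [contract_wedge, sumMap_apply, neg_smul, sub_eq_add_neg, add_comm]
        have e1 := hde (b.coord k) _ hz
        have e2 := hde β _ hz
        rw [hsum] at e1 e2
        simp only [Pi.sub_apply, Pi.mul_apply, ← e1, ← e2]
        simp only [map_smul, LinearMap.smul_apply, smul_eq_mul]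
        ring)
    have e1 := hde (b.coord k) (x₁, x₂) ⟨hx₁, hx₂⟩
    have e2 := hde β (x₁, x₂) ⟨hx₁, hx₂⟩
    simp only [Pi.sub_apply, Pi.mul_apply, hφ] at hG
    simp only [sumMap_apply] at e1 e2
    rw [← e1, ← e2] at hG
    have hne : d (b.coord k) (x₁ + x₂) * d β (x₁ + x₂) * β (wedge x₁ x₂) ≠ 0 :=
      mul_ne_zero (mul_ne_zero (hdk k) hdβ) hβv
    refine mul_left_cancel₀ hne ?_
    linear_combination -hG
  refine span_pair_eq_of_wedge_eq_smul (s := β (wedge x y) * (β (wedge x₁ x₂))⁻¹) hxy ?_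
  refine b.ext_elem fun k => ?_
  have hk := key k
  simp only [Module.Basis.coord_apply] at hk
  rw [map_smul, Finsupp.smul_apply, smul_eq_mul]
  field_simp
  linear_combination hk

end UniqueLine

/-! ### Pairs of points of `X` in terms of vectors of the cone. -/

section UniquePair

variable {E : Type*} [AddCommGroup E] [Module ℂ E]

theorem mk_eq_of_mem_submodule {v : E} (hv : v ≠ 0) {p : ℙ ℂ E} (h : v ∈ p.submodule) :
    Projectivization.mk ℂ v hv = p := by
  rw [p.submodule_eq, Submodule.mem_span_singleton] at h
  obtain ⟨a, ha⟩ := h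
  conv_rhs => rw [← p.mk_rep]
  exact (Projectivization.mk_eq_mk_iff' _ _ _ _ _).2 ⟨a, ha⟩

theorem linSpan_pair (x y : ℙ ℂ E) : linSpan {x, y} = x.submodule ⊔ y.submodule := iSup_pair

theorem mk_submodule_le_iff {v : E} (hv : v ≠ 0) (L : Submodule ℂ E) :
    (Projectivization.mk ℂ v hv).submodule ≤ L ↔ v ∈ L := by
  rw [Projectivization.submodule_mk, Submodule.span_singleton_le_iff_mem]

theorem mk_ne_mk_of_linearIndependent {x y : E} (h : LinearIndependent ℂ ![x, y]) (hx : x ≠ 0)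
    (hy : y ≠ 0) : Projectivization.mk ℂ x hx ≠ Projectivization.mk ℂ y hy := by
  intro h0
  obtain ⟨a, ha⟩ := (Projectivization.mk_eq_mk_iff' _ _ _ _ _).1 h0
  have := (LinearIndependent.pair_iff.1 h) 1 (-a) (by rw [ha.symm]; module)
  exact one_ne_zero this.1

/-- The pair of points of `X` defined by two independent vectors of the cone. -/
theorem pair_isSpanning {X : Set (ℙ ℂ E)} {x y v : E} (hx : x ∈ affineCone X)
    (hy : y ∈ affineCone X) (h : LinearIndependent ℂ ![x, y]) (hv : v ≠ 0) (hsum : x + y = v)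
    (hx0 : x ≠ 0) (hy0 : y ≠ 0) :
    ({Projectivization.mk ℂ x hx0, Projectivization.mk ℂ y hy0} : Set (ℙ ℂ E)) ⊆ X ∧
      ({Projectivization.mk ℂ x hx0, Projectivization.mk ℂ y hy0} : Set (ℙ ℂ E)).ncard = 2 ∧
      (Projectivization.mk ℂ v hv).submodule ≤
        linSpan {Projectivization.mk ℂ x hx0, Projectivization.mk ℂ y hy0} := by
  refine ⟨?_, Set.ncard_pair (mk_ne_mk_of_linearIndependent h hx0 hy0), ?_⟩
  · rintro p (rfl | rfl)
    · exact hx hx0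
    · exact hy hy0
  · rw [mk_submodule_le_iff, linSpan_pair, Projectivization.submodule_mk,
      Projectivization.submodule_mk, ← hsum]
    exact Submodule.add_mem_sup (Submodule.mem_span_singleton_self x)
      (Submodule.mem_span_singleton_self y)

/-- When `p ∈ X`, every other point `q` of `X` gives a pair `{p, q}` whose span contains `p`; all
these pairs must coincide. -/
theorem subset_pair_of_existsUnique_of_mem {X : Set (ℙ ℂ E)} {p : ℙ ℂ E}
    (h : ∃! ξ : Set (ℙ ℂ E), ξ ⊆ X ∧ ξ.ncard = 2 ∧ p.submodule ≤ linSpan ξ) (hp : p ∈ X) :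
    ∃ a b, a ≠ b ∧ X = {a, b} := by
  obtain ⟨ξ, ⟨hξX, hξ2, -⟩, huniq⟩ := h
  obtain ⟨a, b, hab, rfl⟩ := Set.ncard_eq_two.1 hξ2
  have key : ∀ q ∈ X, q ≠ p → ({p, q} : Set (ℙ ℂ E)) = {a, b} := fun q hq hqp =>
    huniq _ ⟨by rintro _ (rfl | rfl) <;> assumption, Set.ncard_pair hqp.symm, by
      rw [linSpan_pair]; exact le_sup_left⟩
  refine ⟨a, b, hab, Set.Subset.antisymm (fun q hq => ?_) hξX⟩
  by_cases hqp : q = p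
  · subst hqp
    by_cases haq : a = q
    · exact Or.inl haq.symm
    · rw [← key a (hξX (by simp)) haq]
      simp
  · rw [← key q hq hqp]
    simp

/-- Otherwise `X` would consist of two points, and two linear forms separating them contradict
irreducibility. -/
theorem notMem_of_existsUnique {X : Set (ℙ ℂ E)} (hX : IsIrreducible X) {p : ℙ ℂ E}
    (h : ∃! ξ : Set (ℙ ℂ E), ξ ⊆ X ∧ ξ.ncard = 2 ∧ p.submodule ≤ linSpan ξ) : p ∉ X := by
  intro hp
  obtain ⟨a, b, hab, rfl⟩ := subset_pair_of_existsUnique_of_mem h hp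
  have hli := Projectivization.linearIndependent_pair_iff_ne.2 hab
  obtain ⟨φ, hφa, hφb⟩ := exists_dual_pair hli 0 1
  obtain ⟨χ, hχa, hχb⟩ := exists_dual_pair hli 1 0
  have hmem : ∀ (ψ : Module.Dual ℂ E) (q : ℙ ℂ E), q ∈ lineZeros ψ ↔ ψ q.rep = 0 := by
    intro ψ q
    refine ⟨fun h => by simpa using h 1, fun h t => by simp [h]⟩
  rcases isPreirreducible_iff_isClosed_union_isClosed.1 hX.2 _ _
    (isClosed_lineZeros (dual_mem_polyFun φ)) (isClosed_lineZeros (dual_mem_polyFun χ)) (by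
      rintro q (rfl | rfl)
      · exact Or.inl ((hmem _ _).2 hφa)
      · exact Or.inr ((hmem _ _).2 hχb)) with h | h
  · have := (hmem _ _).1 (h (by simp : b ∈ _))
    exact one_ne_zero (hφb.symm.trans this)
  · have := (hmem _ _).1 (h (by simp : a ∈ _))
    exact one_ne_zero (hχa.symm.trans this)

theorem linearIndependent_of_mk_add_notMem {X : Set (ℙ ℂ E)} {x y : E} (hx : x ∈ affineCone X)
    (hy : y ∈ affineCone X) (hne : x + y ≠ 0)
    (hX : Projectivization.mk ℂ (x + y) hne ∉ X) : LinearIndependent ℂ ![x, y] := by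
  have hnot : x + y ∉ affineCone X := fun h => hX (h hne)
  by_contra hcon
  refine hnot ?_
  by_cases hx0 : x = 0
  · rwa [hx0, zero_add]
  · rw [LinearIndependent.pair_iff' hx0] at hcon
    push Not at hcon
    obtain ⟨a, rfl⟩ := hcon
    have : x + a • x = (1 + a) • x := by module
    rw [this]
    exact smul_mem_affineCone hx _

/-- Uniqueness of the pair of points of `X` whose span contains a point, in terms of vectors. -/
theorem mem_span_of_existsUnique {X : Set (ℙ ℂ E)} (hX : IsIrreducible X) {v : E} (hv : v ≠ 0)
    (h : ∃! ξ : Set (ℙ ℂ E), ξ ⊆ X ∧ ξ.ncard = 2 ∧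
      (Projectivization.mk ℂ v hv).submodule ≤ linSpan ξ)
    {x y x' y' : E} (hx : x ∈ affineCone X) (hy : y ∈ affineCone X) (hx' : x' ∈ affineCone X)
    (hy' : y' ∈ affineCone X) (hxy : x + y = v) (hxy' : x' + y' = v) :
    LinearIndependent ℂ ![x, y] ∧
      ((x' ∈ Submodule.span ℂ {x} ∧ y' ∈ Submodule.span ℂ {y}) ∨
        (x' ∈ Submodule.span ℂ {y} ∧ y' ∈ Submodule.span ℂ {x})) := by
  have hnot := notMem_of_existsUnique hX h
  have hli : LinearIndependent ℂ ![x, y] := by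
    subst hxy
    exact linearIndependent_of_mk_add_notMem hx hy hv hnot
  have hli' : LinearIndependent ℂ ![x', y'] := by
    subst hxy'
    exact linearIndependent_of_mk_add_notMem hx' hy' hv hnot
  refine ⟨hli, ?_⟩
  have hx0 : x ≠ 0 := hli.ne_zero 0
  have hy0 : y ≠ 0 := hli.ne_zero 1
  have hx0' : x' ≠ 0 := hli'.ne_zero 0
  have hy0' : y' ≠ 0 := hli'.ne_zero 1
  have heq := h.unique (pair_isSpanning hx' hy' hli' hv hxy' hx0' hy0')
    (pair_isSpanning hx hy hli hv hxy hx0 hy0)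
  have hspan : ∀ {a b : E} (ha : a ≠ 0) (hb : b ≠ 0),
      Projectivization.mk ℂ a ha = Projectivization.mk ℂ b hb → a ∈ Submodule.span ℂ {b} := by
    intro a b ha hb hab
    rw [← mk_submodule_le_iff ha, hab, Projectivization.submodule_mk]
  rcases Set.pair_eq_pair_iff.1 heq with ⟨h1, h2⟩ | ⟨h1, h2⟩
  · exact Or.inl ⟨hspan _ _ h1, hspan _ _ h2⟩
  · exact Or.inr ⟨hspan _ _ h1, hspan _ _ h2⟩

/-- A proper secant line is a secant line. -/
theorem isSecantLine_span_pair {X : Set (ℙ ℂ E)} {x y : E} (hx : x ∈ affineCone X)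
    (hy : y ∈ affineCone X) (h : LinearIndependent ℂ ![x, y]) :
    IsSecantLine X (Submodule.span ℂ {x, y}) := by
  have hp : IsPluckerPoint (Submodule.span ℂ {x, y})
      (Projectivization.mk ℂ (wedge x y) (wedge_ne_zero_iff.2 h)) :=
    ⟨x, y, rfl, Projectivization.submodule_mk _ _⟩
  refine ⟨_, hp, subset_closure ⟨_, ?_, hp⟩⟩
  have hx0 : x ≠ 0 := h.ne_zero 0
  have hy0 : y ≠ 0 := h.ne_zero 1
  refine ⟨_, hx hx0, _, hy hy0, mk_ne_mk_of_linearIndependent h hx0 hy0, ?_⟩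
  rw [Projectivization.submodule_mk, Projectivization.submodule_mk, Submodule.span_insert]

end UniquePair

/-! ### From unique decompositions of vectors to the projective statement. -/

section OneSecant

variable {E : Type u} [AddCommGroup E] [Module ℂ E] [Module.Finite ℂ E] [Nontrivial E]

/-- Birationality of the abstract secant variety, from the existence and uniqueness of the
decomposition of a general vector as a sum of two vectors of the cone. -/
theorem one_secant_of_decomposition {X : Set (ℙ ℂ E)} (hXc : IsClosed X) (hXi : IsIrreducible X)
    (hXs : secantVariety X = Set.univ) {c : E → ℂ} (hc : c ∈ polyFun E) (hc0 : c ≠ 0)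
    (hex : ∀ v, c v ≠ 0 → ∃ x₁ ∈ affineCone X, ∃ x₂ ∈ affineCone X, x₁ + x₂ = v ∧
      LinearIndependent ℂ ![x₁, x₂] ∧ ∀ y₁ ∈ affineCone X, ∀ y₂ ∈ affineCone X, y₁ + y₂ = v →
        (y₁ = x₁ ∧ y₂ = x₂) ∨ (y₁ = x₂ ∧ y₂ = x₁)) :
    ∃ U : Set (ℙ ℂ E), IsOpen U ∧ U.Nonempty ∧ ∀ p ∈ U,
      (∃! L : Submodule ℂ E, IsSecantLine X L ∧ p.submodule ≤ L) ∧
      (∃! ξ : Set (ℙ ℂ E), ξ ⊆ X ∧ ξ.ncard = 2 ∧ p.submodule ≤ linSpan ξ) := by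
  obtain ⟨d, hd, hd0, hdL⟩ := exists_unique_secantLine hXc hXi hXs hc hc0
    (fun y₁ hy₁ y₂ hy₂ hcy => by
      obtain ⟨x₁, hx₁, x₂, hx₂, -, hli, hu⟩ := hex _ hcy
      rcases hu y₁ hy₁ y₂ hy₂ rfl with ⟨rfl, rfl⟩ | ⟨rfl, rfl⟩
      · exact wedge_ne_zero_iff.2 hli
      · rw [wedge_swap, neg_ne_zero]
        exact wedge_ne_zero_iff.2 hli)
    (fun y₁ hy₁ y₂ hy₂ z₁ hz₁ z₂ hz₂ hyz hcy => by
      obtain ⟨x₁, hx₁, x₂, hx₂, -, hli, hu⟩ := hex _ hcy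
      rcases hu y₁ hy₁ y₂ hy₂ rfl with ⟨rfl, rfl⟩ | ⟨rfl, rfl⟩ <;>
      rcases hu z₁ hz₁ z₂ hz₂ hyz.symm with ⟨rfl, rfl⟩ | ⟨rfl, rfl⟩ <;> simp)
  have hf : c * d ∈ polyFun E := mul_mem hc hd
  have hf0 : c * d ≠ 0 := fun h0 => mul_ne_zero (M₀ := polyFun E) (a := ⟨c, hc⟩) (b := ⟨d, hd⟩)
    (fun h => hc0 (congrArg Subtype.val h)) (fun h => hd0 (congrArg Subtype.val h))
    (Subtype.ext h0)
  refine ⟨(lineZeros (c * d))ᶜ, (isClosed_lineZeros hf).isOpen_compl, nonempty_compl_lineZeros hf0,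
    fun p hp => ?_⟩
  -- Since `c * d` need not be homogeneous, the representative has to be chosen where it is
  -- non-zero.
  obtain ⟨v, hv, rfl, hcd⟩ := exists_rep_of_notMem_lineZeros hf hp
  rw [Pi.mul_apply] at hcd
  obtain ⟨x₁, hx₁, x₂, hx₂, rfl, hli, hu⟩ := hex v (left_ne_zero_of_mul hcd)
  simp only [mk_submodule_le_iff]
  constructor
  · refine ⟨Submodule.span ℂ {x₁, x₂}, ⟨isSecantLine_span_pair hx₁ hx₂ hli, ?_⟩, fun L hL => ?_⟩
    · exact add_mem (Submodule.subset_span (by simp)) (Submodule.subset_span (by simp))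
    · exact hdL x₁ hx₁ x₂ hx₂ (right_ne_zero_of_mul hcd) L hL.1 hL.2
  · have hx0 : x₁ ≠ 0 := hli.ne_zero 0
    have hy0 : x₂ ≠ 0 := hli.ne_zero 1
    have hpair := pair_isSpanning hx₁ hx₂ hli hv rfl hx0 hy0
    rw [mk_submodule_le_iff] at hpair
    refine ⟨_, hpair, ?_⟩
    rintro ξ ⟨hξX, hξ2, hvξ⟩
    obtain ⟨a, b, hab, rfl⟩ := Set.ncard_eq_two.1 hξ2
    rw [linSpan_pair] at hvξ
    obtain ⟨y₁, hy₁, y₂, hy₂, hy⟩ := Submodule.mem_sup.1 hvξ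
    rcases hu y₁ (mem_affineCone_of_mem_submodule (hξX (by simp)) hy₁) y₂
      (mem_affineCone_of_mem_submodule (hξX (by simp)) hy₂) hy with ⟨rfl, rfl⟩ | ⟨rfl, rfl⟩
    · rw [mk_eq_of_mem_submodule hx0 hy₁, mk_eq_of_mem_submodule hy0 hy₂]
    · rw [mk_eq_of_mem_submodule hx0 hy₂, mk_eq_of_mem_submodule hy0 hy₁, Set.pair_comm]

end OneSecant

/-! ### Verra varieties: unique decomposition of a general vector. -/

section Verra

variable {E : Type u} [AddCommGroup E] [Module ℂ E]

theorem mem_ruling_iff {V W : Submodule ℂ E} (h : IsCompl V W) (y : ℙ ℂ V) (x : E) :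
    x ∈ ruling W y ↔ V.projectionOnto W h x ∈ y.submodule := by
  constructor
  · intro hx
    obtain ⟨a, ⟨a', ha', rfl⟩, w, hw, rfl⟩ := Submodule.mem_sup.1 hx
    rw [map_add, (Submodule.projectionOnto_apply_eq_zero_iff h).2 hw, add_zero,
      Submodule.subtype_apply, Submodule.projectionOnto_apply_left]
    exact ha'
  · intro hx
    refine Submodule.mem_sup.2 ⟨V.projectionOnto W h x, ⟨_, hx, rfl⟩,
      x - V.projectionOnto W h x, ?_, by abel⟩
    rw [← Submodule.projectionOnto_apply_eq_zero_iff h, map_sub,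
      Submodule.projectionOnto_apply_left, sub_self]

variable {n m : ℕ} {V W : Submodule ℂ E} {Y : Set (ℙ ℂ V)} {X : Set (ℙ ℂ E)}

theorem IsVerraOver.module_finite (hX : IsVerraOver n m V W Y X) : Module.Finite ℂ E :=
  Module.finite_of_finrank_pos (by rw [hX.ambient]; omega)

theorem IsVerraOver.isCompl (hX : IsVerraOver n m V W Y X) : IsCompl V W := by
  have := hX.module_finite
  refine (Submodule.isCompl_iff_disjoint V W ?_).2 hX.disjoint
  rw [hX.ambient, hX.base.ambient, hX.finrank_vertex]
  have := hX.lt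
  omega

theorem IsVerraOver.projection_mem (hX : IsVerraOver n m V W Y X) {x : E}
    (hx : x ∈ affineCone X) : V.projectionOnto W hX.isCompl x ∈ affineCone Y := by
  intro h0
  have hx0 : x ≠ 0 := fun h => h0 (by rw [h, map_zero])
  obtain ⟨y, hy, hxy⟩ := hX.subset_cone (hx hx0)
  rw [mk_submodule_le_iff, mem_ruling_iff hX.isCompl] at hxy
  rwa [mk_eq_of_mem_submodule h0 hxy]

/-- The rulings of the cone over a general point meet `X` in linear spaces. -/
theorem IsVerraOver.exists_fibre (hX : IsVerraOver n m V W Y X) :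
    ∃ h ∈ polyFun V, (∃ x ∈ affineCone X, h (V.projectionOnto W hX.isCompl x) ≠ 0) ∧
      ∀ u ∈ affineCone Y, h u ≠ 0 → ∃ P : Submodule ℂ E, Module.finrank ℂ P = n - m + 1 ∧
        ∀ x ∈ affineCone X, V.projectionOnto W hX.isCompl x ≠ 0 →
          V.projectionOnto W hX.isCompl x ∈ Submodule.span ℂ {u} → x ∈ P := by
  obtain ⟨U, hU, ⟨y₀, hy₀U, hy₀Y⟩, hP⟩ := hX.linear_fibre
  obtain ⟨f, hf, hf0, hfU⟩ := exists_polyFun_of_isOpen hU hy₀U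
  -- The factor `l` vanishes at the origin, so that `f * l` being non-zero at `u` forces `u` to
  -- represent a point.
  obtain ⟨l, hl⟩ : ∃ l : Module.Dual ℂ V, l y₀.rep ≠ 0 := by
    by_contra! hcon
    exact y₀.rep_nonzero ((Module.forall_dual_apply_eq_zero_iff ℂ _).1 hcon)
  have hmk : ∀ x : E, ∀ hx : x ≠ 0, ¬ (Projectivization.mk ℂ x hx).submodule ≤ W ↔
      V.projectionOnto W hX.isCompl x ≠ 0 := fun x hx => by
    rw [mk_submodule_le_iff, Ne, Submodule.projectionOnto_apply_eq_zero_iff]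
  refine ⟨f * l, mul_mem hf (dual_mem_polyFun l), ?_, fun u hu hfu => ?_⟩
  · obtain ⟨P, -, hPW, hPX⟩ := hP y₀ ⟨hy₀U, hy₀Y⟩
    obtain ⟨x, hxP, hxW⟩ := SetLike.not_le_iff_exists.1 hPW
    have hx0 : x ≠ 0 := fun h => hxW (h ▸ W.zero_mem)
    have hmem : Projectivization.mk ℂ x hx0 ∈ {x : ℙ ℂ E | x.submodule ≤ P ∧ ¬ x.submodule ≤ W} :=
      ⟨(mk_submodule_le_iff _ _).2 hxP, fun h => hxW ((mk_submodule_le_iff _ _).1 h)⟩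
    rw [← hPX] at hmem
    obtain ⟨hxX, hxy, hxW'⟩ := hmem
    rw [hmk] at hxW'
    rw [mk_submodule_le_iff, mem_ruling_iff hX.isCompl, y₀.submodule_eq,
      Submodule.mem_span_singleton] at hxy
    obtain ⟨a, ha⟩ := hxy
    have ha0 : a ≠ 0 := fun h => hxW' (by rw [← ha, h, zero_smul])
    have hxc : x ∈ affineCone X := fun _ => hxX
    -- Rescaling makes the projection exactly `y₀.rep`, the vector at which `f` and `l` are known to
    -- be non-zero.
    refine ⟨a⁻¹ • x, smul_mem_affineCone hxc _, ?_⟩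
    rw [map_smul, ← ha, smul_smul, inv_mul_cancel₀ ha0, one_smul]
    exact mul_ne_zero hf0 hl
  · have hu0 : u ≠ 0 := fun h => (right_ne_zero_of_mul hfu) (by rw [h, map_zero])
    obtain ⟨P, hPd, -, hPX⟩ := hP (Projectivization.mk ℂ u hu0)
      ⟨hfU u hu0 (left_ne_zero_of_mul hfu), hu hu0⟩
    refine ⟨P, hPd, fun x hx hx0 hxu => ?_⟩
    have hx0' : x ≠ 0 := fun h => hx0 (by rw [h, map_zero])
    have hmem : Projectivization.mk ℂ x hx0' ∈ {x | x ∈ X ∧ x.submodule ≤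
        ruling W (Projectivization.mk ℂ u hu0) ∧ ¬ x.submodule ≤ W} :=
      ⟨hx hx0', by rwa [mk_submodule_le_iff, mem_ruling_iff hX.isCompl,
        Projectivization.submodule_mk], (hmk _ _).2 hx0⟩
    rw [hPX] at hmem
    exact (mk_submodule_le_iff _ _).1 hmem.1

/-- Two linear spaces of complementary dimension in the span of two rulings, whose span contains
the vertex and which are not contained in the vertex, are disjoint. -/
theorem disjoint_of_vertex_le [Module.Finite ℂ E] (h : IsCompl V W) {P₁ P₂ : Submodule ℂ E}
    {k : ℕ} (hW : Module.finrank ℂ W = 2 * k) (h₁ : Module.finrank ℂ P₁ = k + 1)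
    (h₂ : Module.finrank ℂ P₂ = k + 1) (hWP : W ≤ P₁ ⊔ P₂) {x₁ x₂ : E} (hx₁ : x₁ ∈ P₁)
    (hx₂ : x₂ ∈ P₂) (hli : LinearIndependent ℂ
      ![V.projectionOnto W h x₁, V.projectionOnto W h x₂]) : Disjoint P₁ P₂ := by
  have hli' : LinearIndependent ℂ
      ![(V.projectionOnto W h x₁ : E), (V.projectionOnto W h x₂ : E)] := by
    have e : ![(V.projectionOnto W h x₁ : E), (V.projectionOnto W h x₂ : E)] =
        V.subtype ∘ ![V.projectionOnto W h x₁, V.projectionOnto W h x₂] := by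
      ext i
      fin_cases i <;> rfl
    rw [e]
    exact hli.map' V.subtype (Submodule.ker_subtype V)
  -- Containing `W`, the sum is stable under projection to `V`; so it contains the plane `Q ≤ V`
  -- besides `W`, and has dimension at least `2k + 2`, the sum of the dimensions of `P₁` and `P₂`.
  have hsub : ∀ x ∈ P₁ ⊔ P₂, (V.projectionOnto W h x : E) ∈ P₁ ⊔ P₂ := fun x hx => by
    have hw : x - V.projectionOnto W h x ∈ W := by
      rw [← Submodule.projectionOnto_apply_eq_zero_iff h, map_sub,
        Submodule.projectionOnto_apply_left, sub_self]
    simpa using sub_mem hx (hWP hw)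
  set Q := Submodule.span ℂ
    (Set.range ![(V.projectionOnto W h x₁ : E), (V.projectionOnto W h x₂ : E)]) with hQ
  have hQd : Module.finrank ℂ Q = 2 := by
    rw [hQ, finrank_span_eq_card hli', Fintype.card_fin]
  have hQV : Q ≤ V := by
    rw [hQ, Submodule.span_le]
    rintro _ ⟨i, rfl⟩
    fin_cases i <;> simp
  have hQP : Q ≤ P₁ ⊔ P₂ := by
    rw [hQ, Submodule.span_le]
    rintro _ ⟨i, rfl⟩
    fin_cases i
    · exact hsub _ (Submodule.mem_sup_left hx₁)
    · exact hsub _ (Submodule.mem_sup_right hx₂)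
  have e1 := Submodule.finrank_sup_add_finrank_inf_eq Q W
  rw [(h.disjoint.mono_left hQV).eq_bot, finrank_bot, hQd, hW] at e1
  have e2 := Submodule.finrank_sup_add_finrank_inf_eq P₁ P₂
  have e3 := Submodule.finrank_mono (sup_le hQP hWP)
  rw [disjoint_iff, ← Submodule.finrank_eq_zero (R := ℂ)]
  omega

theorem eq_of_add_eq_add_of_disjoint {P₁ P₂ : Submodule ℂ E} (h : Disjoint P₁ P₂) {x₁ x₂ y₁ y₂ : E}
    (hx₁ : x₁ ∈ P₁) (hx₂ : x₂ ∈ P₂) (hy₁ : y₁ ∈ P₁) (hy₂ : y₂ ∈ P₂) (hxy : y₁ + y₂ = x₁ + x₂) :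
    y₁ = x₁ ∧ y₂ = x₂ := by
  have h1 : y₁ - x₁ = x₂ - y₂ := by rw [sub_eq_sub_iff_add_eq_add, hxy, add_comm]
  have h0 : y₁ - x₁ = 0 := Submodule.disjoint_def.1 h _ (sub_mem hy₁ hx₁)
    (h1 ▸ sub_mem hx₂ hy₂)
  exact ⟨sub_eq_zero.1 h0, (sub_eq_zero.1 (h1.symm.trans h0)).symm⟩

/-- Existence comes from non-defectiveness of `X`. For uniqueness, the OADP property of `Y` confines
the summands to two fixed linear fibres, and varying `v` along `W` shows that these fibres are
disjoint. -/
theorem IsVerraOver.exists_decomposition (hX : IsVerraOver n m V W Y X) :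
    ∃ c ∈ polyFun E, c ≠ 0 ∧ ∀ v, c v ≠ 0 → ∃ x₁ ∈ affineCone X, ∃ x₂ ∈ affineCone X,
      x₁ + x₂ = v ∧ LinearIndependent ℂ ![x₁, x₂] ∧
      ∀ y₁ ∈ affineCone X, ∀ y₂ ∈ affineCone X, y₁ + y₂ = v →
        (y₁ = x₁ ∧ y₂ = x₂) ∨ (y₁ = x₂ ∧ y₂ = x₁) := by
  have := hX.module_finite
  have : Nontrivial E := Module.nontrivial_of_finrank_pos (R := ℂ) (by rw [hX.ambient]; omega)
  set π := V.projectionOnto W hX.isCompl with hπ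
  obtain ⟨h, hh, ⟨x₀, hx₀, hhx₀⟩, hP⟩ := hX.exists_fibre
  have hXi := hX.isVariety.irreducible
  have hXc := hX.isVariety.closed
  have hYi := hX.base.isVariety.irreducible
  obtain ⟨c₁, hc₁, hc₁0, hc₁X⟩ := exists_open_subset_image
    ((isPolyIrreducible_affineCone hXi).prod (isPolyIrreducible_affineCone hXi))
    ((isPolyClosed_affineCone hXc hXi.1).prod (isPolyClosed_affineCone hXc hXi.1)) sumMap
    (eq_zero_of_secantVariety_eq_univ hX.not_defective)
    (b := (fun x => h (π x.1)) * (fun x => h (π x.2)))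
    (mul_mem (comp_linear_mem_polyFun hh (π ∘ₗ LinearMap.fst ℂ E E))
      (comp_linear_mem_polyFun hh (π ∘ₗ LinearMap.snd ℂ E E)))
    ⟨(x₀, x₀), ⟨hx₀, hx₀⟩, mul_ne_zero hhx₀ hhx₀⟩
  obtain ⟨U, hU, ⟨q, hq⟩, hUY⟩ := hX.base.one_secant
  obtain ⟨f, hf, hfq, hfU⟩ := exists_polyFun_of_isOpen hU hq
  obtain ⟨l, hl⟩ : ∃ l : Module.Dual ℂ V, l q.rep ≠ 0 := by
    by_contra! hcon
    exact q.rep_nonzero ((Module.forall_dual_apply_eq_zero_iff ℂ _).1 hcon)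
  let C : polyFun E := ⟨c₁, hc₁⟩ * (polyComap π (⟨f, hf⟩ * ⟨l, dual_mem_polyFun l⟩))
  have hC0 : C ≠ 0 := by
    refine mul_ne_zero (fun h0 => hc₁0 (congrArg Subtype.val h0)) fun h0 => ?_
    have h1 : f (π q.rep) * l (π q.rep) = 0 := congrFun (congrArg Subtype.val h0) (q.rep : E)
    rw [hπ, Submodule.projectionOnto_apply_left] at h1
    exact mul_ne_zero hfq hl h1
  have hCv : ∀ v, (C : E → ℂ) v ≠ 0 → c₁ v ≠ 0 ∧ ∃ hv : π v ≠ 0,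
      Projectivization.mk ℂ (π v) hv ∈ U := by
    intro v hv
    have hv' : c₁ v * (f (π v) * l (π v)) ≠ 0 := hv
    have h1 := right_ne_zero_of_mul hv'
    have h2 : π v ≠ 0 := fun h0 => right_ne_zero_of_mul h1 (by rw [h0, map_zero])
    exact ⟨left_ne_zero_of_mul hv', h2, hfU _ h2 (left_ne_zero_of_mul h1)⟩
  refine ⟨C, C.2, fun h0 => hC0 (Subtype.ext h0), fun v hv => ?_⟩
  obtain ⟨hc₁v, hv0, hvU⟩ := hCv v hv
  obtain ⟨⟨x₁, x₂⟩, ⟨hx₁, hx₂⟩, hsum, hb⟩ := hc₁X v hc₁v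
  change x₁ + x₂ = v at hsum
  change h (π x₁) * h (π x₂) ≠ 0 at hb
  -- Only `π v` matters to `Y`, so the same two fibres serve all translates of `v` by vectors of
  -- `W`.
  have hspan : ∀ v', π v' = π v → ∀ y₁ ∈ affineCone X, ∀ y₂ ∈ affineCone X, y₁ + y₂ = v' →
      LinearIndependent ℂ ![π y₁, π y₂] ∧
      ((π y₁ ∈ Submodule.span ℂ {π x₁} ∧ π y₂ ∈ Submodule.span ℂ {π x₂}) ∨
        (π y₁ ∈ Submodule.span ℂ {π x₂} ∧ π y₂ ∈ Submodule.span ℂ {π x₁})) := by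
    intro v' hv' y₁ hy₁ y₂ hy₂ hy
    have hyv : π y₁ + π y₂ = π v := by rw [← map_add, hy, hv']
    have hxv : π x₁ + π x₂ = π v := by rw [← map_add, hsum]
    exact ⟨(mem_span_of_existsUnique hYi hv0 (hUY _ hvU).2 (hX.projection_mem hy₁)
      (hX.projection_mem hy₂) (hX.projection_mem hx₁) (hX.projection_mem hx₂) hyv hxv).1,
      (mem_span_of_existsUnique hYi hv0 (hUY _ hvU).2 (hX.projection_mem hx₁)
      (hX.projection_mem hx₂) (hX.projection_mem hy₁) (hX.projection_mem hy₂) hxv hyv).2⟩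
  obtain ⟨P₁, hd₁, hP₁⟩ := hP (π x₁) (hX.projection_mem hx₁) (left_ne_zero_of_mul hb)
  obtain ⟨P₂, hd₂, hP₂⟩ := hP (π x₂) (hX.projection_mem hx₂) (right_ne_zero_of_mul hb)
  have hmem : ∀ v', π v' = π v → ∀ y₁ ∈ affineCone X, ∀ y₂ ∈ affineCone X, y₁ + y₂ = v' →
      (y₁ ∈ P₁ ∧ y₂ ∈ P₂) ∨ (y₁ ∈ P₂ ∧ y₂ ∈ P₁) := by
    intro v' hv' y₁ hy₁ y₂ hy₂ hy
    obtain ⟨hli, hs⟩ := hspan v' hv' y₁ hy₁ y₂ hy₂ hy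
    rcases hs with ⟨h1, h2⟩ | ⟨h1, h2⟩
    · exact Or.inl ⟨hP₁ _ hy₁ (hli.ne_zero 0) h1, hP₂ _ hy₂ (hli.ne_zero 1) h2⟩
    · exact Or.inr ⟨hP₂ _ hy₁ (hli.ne_zero 0) h1, hP₁ _ hy₂ (hli.ne_zero 1) h2⟩
  have hlix := (hspan v rfl x₁ hx₁ x₂ hx₂ hsum).1
  have hx₁P : x₁ ∈ P₁ := hP₁ _ hx₁ (hlix.ne_zero 0) (Submodule.mem_span_singleton_self _)
  have hx₂P : x₂ ∈ P₂ := hP₂ _ hx₂ (hlix.ne_zero 1) (Submodule.mem_span_singleton_self _)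
  have hWP : W ≤ P₁ ⊔ P₂ := by
    intro w hw
    -- Since `C` is non-zero at `v`, it is non-zero at some `v + t • w` with `t ≠ 0`, which then
    -- also decomposes in `P₁ ⊔ P₂`.
    obtain ⟨t, ht, htv⟩ := exists_ne_zero_line C.2 v w 0 0 (by rwa [zero_smul, add_zero])
    have hπt : π (v + t • w) = π v := by
      rw [map_add, map_smul, (Submodule.projectionOnto_apply_eq_zero_iff hX.isCompl).2 hw,
        smul_zero, add_zero]
    obtain ⟨⟨y₁, y₂⟩, ⟨hy₁, hy₂⟩, hy, -⟩ := hc₁X _ (hCv _ htv).1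
    change y₁ + y₂ = v + t • w at hy
    have hin : v + t • w ∈ P₁ ⊔ P₂ := by
      rw [← hy]
      rcases hmem _ hπt y₁ hy₁ y₂ hy₂ hy with ⟨h1, h2⟩ | ⟨h1, h2⟩
      · exact Submodule.add_mem_sup h1 h2
      · rw [add_comm]
        exact Submodule.add_mem_sup h2 h1
    have hvP : v ∈ P₁ ⊔ P₂ := hsum ▸ Submodule.add_mem_sup hx₁P hx₂P
    have htw := sub_mem hin hvP
    rw [add_sub_cancel_left] at htw
    exact (Submodule.smul_mem_iff _ ht).1 htw
  have hdisj := disjoint_of_vertex_le hX.isCompl hX.finrank_vertex hd₁ hd₂ hWP hx₁P hx₂P hlix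
  refine ⟨x₁, hx₁, x₂, hx₂, hsum, ?_, fun y₁ hy₁ y₂ hy₂ hy => ?_⟩
  · refine LinearIndependent.of_comp π ?_
    convert hlix using 1
    ext i
    fin_cases i <;> rfl
  · rcases hmem v rfl y₁ hy₁ y₂ hy₂ hy with ⟨h1, h2⟩ | ⟨h1, h2⟩
    · exact Or.inl (eq_of_add_eq_add_of_disjoint hdisj hx₁P hx₂P h1 h2 (hy.trans hsum.symm))
    · refine Or.inr ((eq_of_add_eq_add_of_disjoint hdisj hx₁P hx₂P h2 h1 ?_).symm)
      rw [add_comm, hy, hsum]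

end Verra

end OADP

theorem mainTheorem7 {E : Type*} [AddCommGroup E] [Module ℂ E] (n : ℕ)
    (X : Set (Projectivization ℂ E)) (hX : OADP.IsVerra n X) : OADP.IsOADP n X := by
  obtain ⟨m, V, W, Y, h⟩ := hX
  have := h.module_finite
  have : Nontrivial E := Module.nontrivial_of_finrank_pos (R := ℂ) (by rw [h.ambient]; omega)
  obtain ⟨c, hc, hc0, hex⟩ := h.exists_decomposition
  exact ⟨h.ambient, h.isVariety, h.not_defective,
    OADP.one_secant_of_decomposition h.isVariety.closed h.isVariety.irreducible h.not_defective
      hc hc0 hex⟩
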